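/- Let $n\ge 1$ and let $z=(z_1,\dots,z_n)$, $\overline z=(\overline z_1,\dots,\overline z_n)$ be independent complex variables, $\kappa_j=z_j\overline z_j$. Let $\mathcal N$ be the set of formal power series $\sum_{k,\overline k}H_{k,\overline k}z^k\overline z^{\overline k}$ with complex coefficients which contain only monomials with $k=\overline k$, i.e. which are series in $\kappa=(\kappa_1,\dots,\kappa_n)$, and let $\partial_j=\partial/\partial\kappa_j$ on $\mathcal N$, $\langle q,\partial\rangle=\sum_j q_j\partial_j$. Let $\mathcal A$ be the set of series with $|H_{k,\overline k}|\le c\,e^{a(|k|+|\overline k|)}$ for some constants $c,a$. For $\rho>0$ let $D_\rho=\{(z,\overline z)\in\mathbb C^{2n}:|z_j|<\rho,\ |\overline z_j|<\rho \text{ for all } j\}$, and let $\mathcal A^\rho$ be the space of power series converging absolutely in $D_\rho$ to a bounded function, with the norm $\|H\|_\rho=\sup_{D_\rho}|H|$. Let $\omega\in\mathbb R^n$ be nonresonant, i.e. $\langle\omega,p\rangle\neq0$ for all $p\in\mathbb Z^n\setminus\{0\}$; let $q\in\mathbb Z^n\setminus\{0\}$ satisfy $\langle\omega,q\rangle>0$,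 and put $\omega_q=|\langle\omega,q\rangle|$, $\kappa^{[q]}=\prod_j\kappa_j^{|q_j|}$. For $p=\pm q$ let $\mathbf z^{\mathbf k_p}=\prod_j z_j^{\max(-p_j,0)}\,\overline z_j^{\max(p_j,0)}$. Suppose $\widehat N^{q},\widehat N^{-q},\widehat N^0\in\mathcal N\cap\mathcal A$, the series $\mathbf z^{\mathbf k_{q}}\widehat N^{q}$ and $\mathbf z^{\mathbf k_{-q}}\widehat N^{-q}$ have no terms of total degree less than $3$ in $(z,\overline z)$, and $\widehat N^0$ has no terms of degree less than $2$ in $\kappa$. (These are the data of an initial Hamiltonian $\sum_j\omega_jz_j\overline z_j+\mathbf z^{\mathbf k_q}\widehat N^q+\widehat N^0+\mathbf z^{\mathbf k_{-q}}\widehat N^{-q}$ which contains only the harmonics $q,0,-q$.) Then there exists $\widehat\rho>0$ such that the initial value problem $$\partial_\delta N^{\pm q}=-N^{\pm q}\langle q,\partial\rangle N^0,\qquad \partial_\delta N^0=-2e^{-2\omega_q\delta}\,\langle q,\partial\rangle\big(\kappa^{[q]}N^{-q}N^q\big),\qquad N^{\pm q}|_{\delta=0}=\widehat N^{\pm q},\quad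 N^0|_{\delta=0}=\widehat N^0,$$ understood as a system of differential equations for the Taylor coefficients, has a solution $N^{q},N^{-q},N^0$ on $[0,+\infty)$ with $N^{q}(\delta),N^{-q}(\delta),N^0(\delta)\in\mathcal N\cap\mathcal A^{\widehat\rho}$ for all $\delta\ge0$. Moreover, $$\lim_{\delta\to+\infty}\big\|e^{-\omega_q\delta}N^{\pm q}(\delta)\big\|_{\widehat\rho}=0,$$ and there is $N^\infty\in\mathcal N\cap\mathcal A^{\widehat\rho}$ such that $\lim_{\delta\to+\infty}\|N^0(\delta)-N^\infty\|_{\widehat\rho}=0$. -/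

import Mathlib

namespace NormalizationFlow

noncomputable section

/-- The space of formal power series in `z_1, …, z_n, z̄_1, …, z̄_n`: the variable `Sum.inl j` is `z_j`
and the variable `Sum.inr j` is `z̄_j` (an independent variable). -/
abbrev FormalSeries (n : ℕ) : Type := MvPowerSeries (Fin n ⊕ Fin n) ℂ

/-- Multi-indices `(k, k̄)`. -/
abbrev MultiIndex (n : ℕ) : Type := (Fin n ⊕ Fin n) →₀ ℕ

/-- The frequency vector `ω` is nonresonant. -/
def Nonresonant {n : ℕ} (ω : Fin n → ℝ) : Prop :=
  ∀ q : Fin n → ℤ, q ≠ 0 → ∑ j, ω j * (q j : ℝ) ≠ 0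

/-- `ω_q = |⟨ω, q⟩|`. -/
def freq {n : ℕ} (ω : Fin n → ℝ) (q : Fin n → ℤ) : ℝ := |∑ j, ω j * (q j : ℝ)|

/-- `σ_q = sign ⟨ω, q⟩`. -/
def freqSign {n : ℕ} (ω : Fin n → ℝ) (q : Fin n → ℤ) : SignType :=
  SignType.sign (∑ j, ω j * (q j : ℝ))

/-- The series depending on `z, z̄` only through the products `κ_j = z_j z̄_j`. -/
def normalForms (n : ℕ) : Set (FormalSeries n) :=
  {H | ∀ k : MultiIndex n, MvPowerSeries.coeff k H ≠ 0 → ∀ j : Fin n, k (Sum.inl j) = k (Sum.inr j)}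

/-- The analytic series: `|H_k| ≤ c e^{a|k|}` for some `c`, `a`. -/
def analyticSeries (n : ℕ) : Set (FormalSeries n) :=
  {H | ∃ c a : ℝ, ∀ k : MultiIndex n, ‖MvPowerSeries.coeff k H‖ ≤ c * Real.exp (a * (k.degree : ℝ))}

/-- The open polydisk `D_ρ` in `ℂ^{2n}`. -/
def polydisk (n : ℕ) (ρ : ℝ) : Set (Fin n ⊕ Fin n → ℂ) := {z | ∀ j, ‖z j‖ < ρ}

/-- The term `H_k z^k` of the series `H` at the point `z`. -/
def term {n : ℕ} (H : FormalSeries n) (z : Fin n ⊕ Fin n → ℂ) (k : MultiIndex n) : ℂ :=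
  MvPowerSeries.coeff k H * k.prod (fun j e => z j ^ e)

/-- The value `H(z)` (meaningful where the series converges absolutely). -/
def value {n : ℕ} (H : FormalSeries n) (z : Fin n ⊕ Fin n → ℂ) : ℂ := ∑' k, term H z k

/-- The space `A^ρ`: series that converge absolutely in `D_ρ` to a bounded function. -/
def boundedAnalytic (n : ℕ) (ρ : ℝ) : Set (FormalSeries n) :=
  {H | (∀ z ∈ polydisk n ρ, Summable (term H z)) ∧
    BddAbove ((fun z => ‖value H z‖) '' polydisk n ρ)}

/-- The norm `‖H‖_ρ = sup_{z ∈ D_ρ} |H(z)|` on `A^ρ`. -/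
def supNorm {n : ℕ} (ρ : ℝ) (H : FormalSeries n) : ℝ :=
  sSup ((fun z => ‖value H z‖) '' polydisk n ρ)

/-- The multi-index `(l, l)`, the exponent of `κ^l`. -/
def diag {n : ℕ} (l : Fin n → ℕ) : MultiIndex n := Finsupp.equivFunOnFinite.symm (Sum.elim l l)

/-- The monomial `κ^l = ∏_j (z_j z̄_j)^{l_j}`. -/
def kappaPow {n : ℕ} (l : Fin n → ℕ) : FormalSeries n := MvPowerSeries.monomial (diag l) 1

/-- The minimal index `(k_q, k̄_q)` with `k̄_q - k_q = q` and `min (k_q)_j (k̄_q)_j = 0`. -/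
def minIndex {n : ℕ} (q : Fin n → ℤ) : MultiIndex n :=
  Finsupp.equivFunOnFinite.symm (Sum.elim (fun j => (-q j).toNat) (fun j => (q j).toNat))

/-- The monomial `z^{k_q} z̄^{k̄_q}`. -/
def harmonicMonomial {n : ℕ} (q : Fin n → ℤ) : FormalSeries n :=
  MvPowerSeries.monomial (minIndex q) 1

/-- `H = O_m(z, z̄)`: all terms of total degree less than `m` vanish. -/
def IsOrder {n : ℕ} (m : ℕ) (H : FormalSeries n) : Prop :=
  ∀ k : MultiIndex n, k.degree < m → MvPowerSeries.coeff k H = 0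

/-- `N = O_m(κ)` for a normal form `N`: the terms in `κ^l` with `|l| < m` vanish. -/
def IsOrderKappa {n : ℕ} (m : ℕ) (N : FormalSeries n) : Prop :=
  ∀ l : Fin n → ℕ, ∑ j, l j < m → MvPowerSeries.coeff (diag l) N = 0

/-- The derivative `∂/∂κ_j` of a normal form:
it sends `∑ N_l κ^l` to `∑ (l_j + 1) N_{l + e_j} κ^l`. It is only used on normal forms. -/
def kappaDeriv {n : ℕ} (j : Fin n) (N : FormalSeries n) : FormalSeries n :=
  fun k => ((k (Sum.inl j) : ℂ) + 1) * MvPowerSeries.coeff (k + diag (Pi.single j 1)) N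

/-- `⟨q, ∂⟩ N = ∑_j q_j ∂N/∂κ_j`. -/
def dirDeriv {n : ℕ} (q : Fin n → ℤ) (N : FormalSeries n) : FormalSeries n :=
  ∑ j, (q j : ℂ) • kappaDeriv j N

/-- The curve `γ` of formal series satisfies `∂_δ γ = Φ` for all `δ ≥ 0` (one-sided at `δ = 0`),
in the sense of Taylor coefficients. -/
def SatisfiesODE {n : ℕ} (γ Φ : ℝ → FormalSeries n) : Prop :=
  ∀ δ : ℝ, 0 ≤ δ → ∀ k : MultiIndex n,
    HasDerivWithinAt (fun t => MvPowerSeries.coeff k (γ t)) (MvPowerSeries.coeff k (Φ δ))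
      (Set.Ici 0) δ

/-- `(Np, Nm, N0)`, standing for `(N^q, N^{-q}, N^0)`, is a solution on `[0, ∞)` in the space of
normal forms of the system
`∂_δ N^{±q} = -N^{±q} ⟨q,∂⟩N^0`, `∂_δ N^0 = -2 ⟨q,∂⟩(κ^{[q]} N^{-q} N^q) e^{-2 ω_q δ}`
with the initial values `(Np', Nm', N0')`. -/
structure IsSolution {n : ℕ} (ω : Fin n → ℝ) (q : Fin n → ℤ) (Np' Nm' N0' : FormalSeries n)
    (Np Nm N0 : ℝ → FormalSeries n) : Prop where
  normal : ∀ δ : ℝ, 0 ≤ δ →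
    Np δ ∈ normalForms n ∧ Nm δ ∈ normalForms n ∧ N0 δ ∈ normalForms n
  init_p : Np 0 = Np'
  init_m : Nm 0 = Nm'
  init_0 : N0 0 = N0'
  ode_p : SatisfiesODE Np (fun δ => -(Np δ * dirDeriv q (N0 δ)))
  ode_m : SatisfiesODE Nm (fun δ => -(Nm δ * dirDeriv q (N0 δ)))
  ode_0 : SatisfiesODE N0 (fun δ => ((-2 * Real.exp (-2 * freq ω q * δ) : ℝ) : ℂ) •
    dirDeriv q (kappaPow (fun j => (q j).natAbs) * Nm δ * Np δ))

end

end NormalizationFlow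

namespace NormalizationFlow

noncomputable section

open Finset MvPowerSeries Filter Topology

/-! The equations for `N^q` and `N^{-q}` are linear with the same coefficient, so both solutions are
their initial values times one multiplier `U`, where `∂U = -U ⟨q,∂⟩N⁰` and `U(0) = 1`. With `P =
κ^{[q]} N^{-q}(0) N^q(0)` the product driving `N⁰` is `P U²`, and everything reduces to a fixed
point of `picard`. Since `P` starts in degree 6, `N⁰(0)` in degree 4, and `⟨q,∂⟩` lowers degrees by
2, each Picard step settles at least one more degree. The iterates stabilise coefficientwise, and
`picard_multiplier` gives a formal solution for all times.

The analytic difficulty is that `⟨q,∂⟩` costs a factor of the order of the degree `d`. Put `ω_q =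
2c`, `λ = 2 - e^{-ct}`, and bound the degree `d` part of `U` by `(Rλ)^d (d+1)⁻² e^{ct} / (1 + d
e^{-ct})`. The last quotient is at most `e^{ct}`, and `d` times it is at most `e^{2ct}`. Hence a
derivative of `P U²` grows at most like `e^{3ct}`, and the factor `e^{-2 ω_q t} = e^{-4ct}` leaves
an integrable `e^{-ct}` (`homNorm_averageRate_le`). As `λ' = c e^{-ct}`, integrating `λ^d λ'` gains
back a factor `d + 1`, so `⟨q,∂⟩N⁰` stays bounded by a small multiple of `c`
(`Admissible.weightBound_dirDeriv`). This is less than what the majorant of `U` tolerates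
(`exists_hasDerivAt_multiplierMajorant`), so Picard steps preserve it
(`Admissible.homNorm_picard_le`).

Because `λ ≤ 2`, one radius serves all times. The smallness needed holds for large `R`, thanks to
the orders of vanishing (`eventually_admissible`). Finally `N^{±q} = O(e^{ct})` is beaten by
`e^{-2ct}`, and `N⁰` is Cauchy at rate `e^{-ct}` (`exists_limit`). -/

/-! ### Degreewise `ℓ¹` norms of products and derivatives. -/

/-- The finite set of multi-indices of total degree `d`. -/
def degreeIndices (n d : ℕ) : Finset (MultiIndex n) := Finset.finsuppAntidiag Finset.univ d

theorem mem_degreeIndices {n d : ℕ} {k : MultiIndex n} :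
    k ∈ degreeIndices n d ↔ k.degree = d := by
  simp [degreeIndices, Finset.mem_finsuppAntidiag, Finsupp.degree_eq_sum]

/-- The `ℓ¹` norm of the homogeneous component of degree `d`. -/
def homNorm {n : ℕ} (d : ℕ) (H : FormalSeries n) : ℝ := ∑ k ∈ degreeIndices n d, ‖coeff k H‖

theorem homNorm_nonneg {n : ℕ} (d : ℕ) (H : FormalSeries n) : 0 ≤ homNorm d H :=
  Finset.sum_nonneg fun _ _ => norm_nonneg _

/-- Degree is additive, so the pairs of multi-indices in the Cauchy product regroup according to the
degrees of the two factors. -/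
theorem homNorm_mul_le {n : ℕ} (d : ℕ) (F G : FormalSeries n) :
    homNorm d (F * G) ≤ ∑ p ∈ antidiagonal d, homNorm p.1 F * homNorm p.2 G := by
  classical
  have h1 : homNorm d (F * G) ≤ ∑ k ∈ degreeIndices n d, ∑ p ∈ antidiagonal k,
      ‖coeff p.1 F‖ * ‖coeff p.2 G‖ := by
    refine Finset.sum_le_sum fun k _ => ?_
    rw [coeff_mul]
    refine (norm_sum_le _ _).trans (le_of_eq ?_)
    simp
  refine h1.trans (le_of_eq ?_)
  simp only [homNorm, Finset.sum_mul_sum, ← Finset.sum_product']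
  rw [Finset.sum_sigma', Finset.sum_sigma']
  refine Finset.sum_bij' (fun x _ => ⟨(x.2.1.degree, x.2.2.degree), x.2⟩)
    (fun x _ => ⟨x.2.1 + x.2.2, x.2⟩) ?_ ?_ ?_ ?_ ?_
  · rintro ⟨k, a, b⟩ h
    simp only [mem_sigma, mem_degreeIndices, HasAntidiagonal.mem_antidiagonal, mem_product] at h ⊢
    obtain ⟨rfl, rfl⟩ := h
    simp [map_add]
  · rintro ⟨k, a, b⟩ h
    simp only [mem_sigma, mem_degreeIndices, HasAntidiagonal.mem_antidiagonal, mem_product] at h ⊢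
    obtain ⟨h1, h2, h3⟩ := h
    simp [map_add, h2, h3, h1]
  · rintro ⟨k, a, b⟩ h
    simp only [mem_sigma, mem_degreeIndices, HasAntidiagonal.mem_antidiagonal] at h ⊢
    obtain ⟨rfl, rfl⟩ := h
    rfl
  · rintro ⟨⟨i, j⟩, a, b⟩ h
    simp only [mem_sigma, mem_degreeIndices, HasAntidiagonal.mem_antidiagonal, mem_product] at h ⊢
    obtain ⟨h1, rfl, rfl⟩ := h
    rfl
  · rintro ⟨k, a, b⟩ h
    rfl

theorem degree_diag {n : ℕ} (l : Fin n → ℕ) : (diag l).degree = 2 * ∑ j, l j := by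
  simp [diag, Finsupp.degree_eq_sum, two_mul]

theorem degree_diag_single {n : ℕ} (j : Fin n) :
    (diag (Pi.single j 1 : Fin n → ℕ)).degree = 2 := by
  simp [degree_diag]

theorem coeff_dirDeriv {n : ℕ} (q : Fin n → ℤ) (N : FormalSeries n) (k : MultiIndex n) :
    coeff k (dirDeriv q N) = ∑ j, (q j : ℂ) *
      (((k (Sum.inl j) : ℂ) + 1) * coeff (k + diag (Pi.single j 1)) N) := by
  simp only [dirDeriv, map_sum, map_smul, smul_eq_mul]
  rfl

/-- A positive upper bound for the `ℓ¹` norm of `q`. -/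
def dirSize {n : ℕ} (q : Fin n → ℤ) : ℝ := 1 + ∑ j, ‖(q j : ℂ)‖

theorem dirSize_pos {n : ℕ} (q : Fin n → ℤ) : 0 < dirSize q := by
  unfold dirSize; positivity

/-- A derivative in `κ_j` shifts indices injectively by degree 2, and its numerical factor is at
most `d + 1`. This is the loss that the majorants must absorb. -/
theorem homNorm_dirDeriv_le {n : ℕ} (q : Fin n → ℤ) (d : ℕ) (N : FormalSeries n) :
    homNorm d (dirDeriv q N) ≤ dirSize q * (d + 1) * homNorm (d + 2) N := by
  have h1 : homNorm d (dirDeriv q N) ≤ ∑ k ∈ degreeIndices n d, ∑ j, ‖(q j : ℂ)‖ *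
      ((d + 1) * ‖coeff (k + diag (Pi.single j 1)) N‖) := by
    refine Finset.sum_le_sum fun k hk => ?_
    rw [coeff_dirDeriv]
    refine (norm_sum_le _ _).trans (Finset.sum_le_sum fun j _ => ?_)
    rw [norm_mul, norm_mul]
    gcongr
    have h2 : k (Sum.inl j) ≤ d := by
      rw [← mem_degreeIndices.1 hk]; exact Finsupp.le_degree _ _
    calc ‖(k (Sum.inl j) : ℂ) + 1‖ = ‖((k (Sum.inl j) + 1 : ℕ) : ℂ)‖ := by push_cast; rfl
      _ = (k (Sum.inl j) + 1 : ℕ) := Complex.norm_natCast _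
      _ ≤ d + 1 := by exact_mod_cast Nat.succ_le_succ h2
  refine h1.trans ?_
  rw [Finset.sum_comm]
  have h3 : ∀ j : Fin n, ∑ k ∈ degreeIndices n d, ‖coeff (k + diag (Pi.single j 1)) N‖
      ≤ homNorm (d + 2) N := by
    intro j
    have e := Finset.sum_map (degreeIndices n d) (addRightEmbedding (diag (Pi.single j 1)))
      (fun k => ‖coeff k N‖)
    simp only [addRightEmbedding_apply] at e
    rw [← e]
    refine Finset.sum_le_sum_of_subset_of_nonneg ?_ fun _ _ _ => norm_nonneg _
    intro k hk
    obtain ⟨m, hm, rfl⟩ := Finset.mem_map.1 hk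
    rw [mem_degreeIndices] at hm ⊢
    simp [map_add, hm, degree_diag_single]
  have h4 : 0 ≤ homNorm (d + 2) N := homNorm_nonneg _ _
  calc _ = ∑ j, ‖(q j : ℂ)‖ * ((d + 1) *
        ∑ k ∈ degreeIndices n d, ‖coeff (k + diag (Pi.single j 1)) N‖) := by
        simp only [Finset.mul_sum]
    _ ≤ ∑ j, ‖(q j : ℂ)‖ * ((d + 1) * homNorm (d + 2) N) := by
        gcongr with j; exact h3 j
    _ = (∑ j, ‖(q j : ℂ)‖) * (d + 1) * homNorm (d + 2) N := by
        rw [← Finset.sum_mul]; ring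
    _ ≤ _ := by
        unfold dirSize
        gcongr
        linarith

/-! ### Normal forms -/

theorem one_mem_normalForms (n : ℕ) : (1 : FormalSeries n) ∈ normalForms n := by
  classical
  intro k hk j
  rw [coeff_one] at hk
  have : k = 0 := by by_contra h; simp [h] at hk
  simp [this]

theorem mul_mem_normalForms {n : ℕ} {F G : FormalSeries n} (hF : F ∈ normalForms n)
    (hG : G ∈ normalForms n) : F * G ∈ normalForms n := by
  classical
  intro k hk j
  rw [coeff_mul] at hk
  obtain ⟨p, hp, h⟩ := Finset.exists_ne_zero_of_sum_ne_zero hk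
  rw [← HasAntidiagonal.mem_antidiagonal.1 hp]
  have h1 := hF p.1 (left_ne_zero_of_mul h) j
  have h2 := hG p.2 (right_ne_zero_of_mul h) j
  simp [h1, h2]

theorem kappaPow_mem_normalForms {n : ℕ} (l : Fin n → ℕ) : kappaPow l ∈ normalForms n := by
  classical
  intro k hk j
  rw [kappaPow, coeff_monomial] at hk
  have : k = diag l := by by_contra h; simp [h] at hk
  simp [this, diag]

theorem dirDeriv_mem_normalForms {n : ℕ} (q : Fin n → ℤ) {N : FormalSeries n}
    (hN : N ∈ normalForms n) : dirDeriv q N ∈ normalForms n := by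
  intro k hk j
  rw [coeff_dirDeriv] at hk
  obtain ⟨i, -, h⟩ := Finset.exists_ne_zero_of_sum_ne_zero hk
  have := hN _ (right_ne_zero_of_mul (right_ne_zero_of_mul h)) j
  simpa [diag] using this

/-! ### Orders of vanishing -/

theorem IsOrder.mul {n a b : ℕ} {F G : FormalSeries n} (hF : IsOrder a F) (hG : IsOrder b G) :
    IsOrder (a + b) (F * G) := by
  classical
  intro k hk
  rw [coeff_mul]
  refine Finset.sum_eq_zero fun p hp => ?_
  rw [← HasAntidiagonal.mem_antidiagonal.1 hp, map_add] at hk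
  by_cases h : p.1.degree < a
  · rw [hF _ h, zero_mul]
  · rw [hG _ (by omega), mul_zero]

theorem IsOrder.dirDeriv {n a : ℕ} (q : Fin n → ℤ) {N : FormalSeries n} (hN : IsOrder (a + 2) N) :
    IsOrder a (dirDeriv q N) := by
  intro k hk
  rw [coeff_dirDeriv]
  refine Finset.sum_eq_zero fun j _ => ?_
  rw [hN, mul_zero, mul_zero]
  rw [map_add, degree_diag_single]; omega

theorem IsOrder.homNorm_eq_zero {n a d : ℕ} {F : FormalSeries n} (hF : IsOrder a F) (hd : d < a) :
    homNorm d F = 0 :=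
  Finset.sum_eq_zero fun k hk => by rw [hF k (by rw [mem_degreeIndices.1 hk]; exact hd), norm_zero]

theorem isOrder_of_isOrderKappa {n m : ℕ} {N : FormalSeries n} (hN : N ∈ normalForms n)
    (h : IsOrderKappa m N) : IsOrder (2 * m) N := by
  intro k hk
  by_contra h0
  have h1 : k = diag (fun j => k (Sum.inl j)) := by
    ext i
    rcases i with j | j
    · simp [diag]
    · simp [diag, hN k h0 j]
  rw [h1, degree_diag] at hk
  exact h0 (h1 ▸ h _ (by omega))

theorem harmonicMonomial_mul_neg {n : ℕ} (q : Fin n → ℤ) :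
    harmonicMonomial q * harmonicMonomial (-q) = kappaPow (fun j => (q j).natAbs) := by
  have h : minIndex q + minIndex (-q) = diag (fun j => (q j).natAbs) := by
    ext i
    rcases i with j | j
    · change (-q j).toNat + (- -q j).toNat = (q j).natAbs
      omega
    · change (q j).toNat + (-q j).toNat = (q j).natAbs
      omega
  rw [harmonicMonomial, harmonicMonomial, monomial_mul_monomial, kappaPow, mul_one, h]

/-- `κ^{[q]}` splits into the two harmonic monomials, so the orders 3 of the two harmonics add. -/
theorem isOrder_kappaPow_mul {n : ℕ} {q : Fin n → ℤ} {F G : FormalSeries n}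
    (hF : IsOrder 3 (harmonicMonomial q * F)) (hG : IsOrder 3 (harmonicMonomial (-q) * G)) :
    IsOrder 6 (kappaPow (fun j => (q j).natAbs) * G * F) := by
  have h := hF.mul hG
  rw [← harmonicMonomial_mul_neg]
  convert h using 1
  ring

/-! ### Geometric bounds -/

/-- The indices lie in a box with `(d+1)^{2n}` points, and `d + 1 ≤ 2^d`. -/
theorem card_degreeIndices_le (n d : ℕ) : ((degreeIndices n d).card : ℝ) ≤ ((4 : ℝ) ^ n) ^ d := by
  have h1 : (degreeIndices n d).card ≤ (Fintype.piFinset fun _ : Fin n ⊕ Fin n =>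
      Finset.range (d + 1)).card := by
    refine Finset.card_le_card_of_injOn (fun k => ⇑k) ?_ (DFunLike.coe_injective.injOn)
    intro k hk
    simp only [Finset.mem_coe, Fintype.mem_piFinset, Finset.mem_range] at hk ⊢
    intro i
    rw [← mem_degreeIndices.1 hk]
    exact Nat.lt_succ_of_le (Finsupp.le_degree _ _)
  have h2 : (d + 1 : ℕ) ≤ 2 ^ d := Nat.lt_two_pow_self
  have h3 : (degreeIndices n d).card ≤ (4 ^ n) ^ d := by
    refine h1.trans ?_
    rw [Fintype.card_piFinset]
    simp only [Finset.card_range, Finset.prod_const, Finset.card_univ, Fintype.card_sum,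
      Fintype.card_fin]
    calc (d + 1) ^ (n + n) ≤ (2 ^ d) ^ (n + n) := Nat.pow_le_pow_left h2 _
      _ = (4 ^ n) ^ d := by
        rw [show 4 = 2 ^ 2 from rfl, ← pow_mul, ← pow_mul, ← pow_mul]; congr 1; ring
  exact_mod_cast h3

/-- Geometric growth of the homogeneous components. -/
def GeomBound {n : ℕ} (C R : ℝ) (H : FormalSeries n) : Prop := ∀ d, homNorm d H ≤ C * R ^ d

theorem GeomBound.mono {n : ℕ} {C R C' R' : ℝ} {H : FormalSeries n} (h : GeomBound C R H)
    (hC : C ≤ C') (hC' : 0 ≤ C') (hR : 0 ≤ R) (hR' : R ≤ R') : GeomBound C' R' H := fun d =>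
  (h d).trans (mul_le_mul hC (pow_le_pow_left₀ hR hR' _) (by positivity) hC')

theorem exists_geomBound {n : ℕ} {H : FormalSeries n} (h : H ∈ analyticSeries n) :
    ∃ C R : ℝ, 0 < C ∧ 0 < R ∧ GeomBound C R H := by
  obtain ⟨c, a, h⟩ := h
  refine ⟨|c| + 1, 4 ^ n * Real.exp a, by positivity, by positivity, fun d => ?_⟩
  have h1 : ∀ k ∈ degreeIndices n d, ‖coeff k H‖ ≤ (|c| + 1) * Real.exp a ^ d := by
    intro k hk
    refine (h k).trans ?_
    rw [mem_degreeIndices.1 hk, mul_comm a, Real.exp_nat_mul]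
    gcongr
    linarith [le_abs_self c]
  refine (Finset.sum_le_card_nsmul _ _ _ h1).trans ?_
  rw [nsmul_eq_mul, mul_pow]
  have := card_degreeIndices_le n d
  calc _ ≤ ((4 : ℝ) ^ n) ^ d * ((|c| + 1) * Real.exp a ^ d) := by gcongr
    _ = _ := by ring

/-- The `d + 1` terms of the convolution are absorbed into `2^d`; this crude loss is harmless when
incurred only finitely often. -/
theorem GeomBound.mul {n : ℕ} {C C' R : ℝ} {F G : FormalSeries n} (hC : 0 ≤ C)
    (hR : 0 ≤ R) (hF : GeomBound C R F) (hG : GeomBound C' R G) :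
    GeomBound (C * C') (2 * R) (F * G) := by
  intro d
  have hC' : 0 ≤ C' := by simpa using (homNorm_nonneg 0 G).trans (hG 0)
  refine (homNorm_mul_le d F G).trans ?_
  have h1 : ∀ p ∈ antidiagonal d, homNorm p.1 F * homNorm p.2 G ≤ C * C' * R ^ d := by
    intro p hp
    calc _ ≤ (C * R ^ p.1) * (C' * R ^ p.2) :=
          mul_le_mul (hF _) (hG _) (homNorm_nonneg _ _) (by positivity)
      _ = C * C' * R ^ (p.1 + p.2) := by ring
      _ = _ := by rw [HasAntidiagonal.mem_antidiagonal.1 hp]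
  refine (Finset.sum_le_card_nsmul _ _ _ h1).trans ?_
  rw [Finset.Nat.card_antidiagonal, nsmul_eq_mul, mul_pow]
  have h2 : ((d + 1 : ℕ) : ℝ) ≤ 2 ^ d := by exact_mod_cast (Nat.lt_two_pow_self : d < 2 ^ d)
  calc _ ≤ (2 : ℝ) ^ d * (C * C' * R ^ d) := by gcongr
    _ = _ := by ring

theorem exists_geomBound_mul {n : ℕ} {F G : FormalSeries n}
    (hF : ∃ C R : ℝ, 0 < C ∧ 0 < R ∧ GeomBound C R F)
    (hG : ∃ C R : ℝ, 0 < C ∧ 0 < R ∧ GeomBound C R G) :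
    ∃ C R : ℝ, 0 < C ∧ 0 < R ∧ GeomBound C R (F * G) := by
  obtain ⟨C, R, hC, hR, hF⟩ := hF
  obtain ⟨C', R', hC', hR', hG⟩ := hG
  have hm : 0 < max R R' := lt_max_of_lt_left hR
  exact ⟨C * C', 2 * max R R', by positivity, by positivity,
    GeomBound.mul hC.le hm.le (hF.mono le_rfl hC.le hR.le (le_max_left _ _))
      (hG.mono le_rfl hC'.le hR'.le (le_max_right _ _))⟩

theorem kappaPow_mem_analyticSeries {n : ℕ} (l : Fin n → ℕ) : kappaPow l ∈ analyticSeries n := by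
  classical
  refine ⟨1, 0, fun k => ?_⟩
  rw [kappaPow, coeff_monomial]
  split_ifs <;> simp

/-- Sorting by degree leaves a geometric series of ratio `R ρ ≤ 1/2`. -/
theorem sum_norm_coeff_mul_pow_le {n : ℕ} {C R ρ : ℝ} {H : FormalSeries n} (hH : GeomBound C R H)
    (hρ : 0 < ρ) (hR : 0 ≤ R) (hRρ : R * ρ ≤ 1 / 2) (s : Finset (MultiIndex n)) :
    ∑ k ∈ s, ‖coeff k H‖ * ρ ^ k.degree ≤ 2 * C := by
  classical
  have hC : 0 ≤ C := by simpa using (homNorm_nonneg 0 H).trans (hH 0)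
  obtain ⟨D, hD⟩ : ∃ D, ∀ k ∈ s, k.degree < D :=
    ⟨s.sup (fun k => k.degree) + 1, fun k hk =>
      Nat.lt_succ_of_le (Finset.le_sup (f := fun k : MultiIndex n => k.degree) hk)⟩
  calc _ = ∑ d ∈ range D, ∑ k ∈ s with k.degree = d, ‖coeff k H‖ * ρ ^ k.degree :=
        (Finset.sum_fiberwise_of_maps_to (fun k hk => Finset.mem_range.2 (hD k hk)) _).symm
    _ ≤ ∑ d ∈ range D, homNorm d H * ρ ^ d := by
        refine Finset.sum_le_sum fun d _ => ?_
        rw [homNorm, Finset.sum_mul]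
        have : ∀ k ∈ s.filter (fun k => k.degree = d), ‖coeff k H‖ * ρ ^ k.degree
            = ‖coeff k H‖ * ρ ^ d := fun k hk => by rw [(Finset.mem_filter.1 hk).2]
        rw [Finset.sum_congr rfl this]
        refine Finset.sum_le_sum_of_subset_of_nonneg (fun k hk => ?_) fun _ _ _ => by positivity
        exact mem_degreeIndices.2 (Finset.mem_filter.1 hk).2
    _ ≤ ∑ d ∈ range D, C * (1 / 2) ^ d := by
        refine Finset.sum_le_sum fun d _ => ?_
        calc _ ≤ C * R ^ d * ρ ^ d := by gcongr; exact hH d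
          _ = C * (R * ρ) ^ d := by ring
          _ ≤ _ := by gcongr
    _ ≤ 2 * C := by
        rw [← Finset.mul_sum, mul_comm 2]
        gcongr
        have := Summable.sum_le_tsum (range D) (fun i _ => by positivity)
          summable_geometric_two
        rwa [tsum_geometric_two] at this

theorem norm_term_le {n : ℕ} {ρ : ℝ} (H : FormalSeries n) {z : Fin n ⊕ Fin n → ℂ}
    (hz : z ∈ polydisk n ρ) (k : MultiIndex n) : ‖term H z k‖ ≤ ‖coeff k H‖ * ρ ^ k.degree := by
  rw [term, norm_mul, Finsupp.prod, norm_prod, Finsupp.degree_apply, ← Finset.prod_pow_eq_pow_sum]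
  gcongr with i _
  rw [norm_pow]
  gcongr
  exact (hz i).le

theorem summable_norm_term {n : ℕ} {C R ρ : ℝ} {H : FormalSeries n} (hH : GeomBound C R H)
    (hρ : 0 < ρ) (hR : 0 ≤ R) (hRρ : R * ρ ≤ 1 / 2) {z : Fin n ⊕ Fin n → ℂ}
    (hz : z ∈ polydisk n ρ) : Summable fun k => ‖term H z k‖ :=
  summable_of_sum_le (fun _ => norm_nonneg _) fun s =>
    (Finset.sum_le_sum fun k _ => norm_term_le H hz k).trans
      (sum_norm_coeff_mul_pow_le hH hρ hR hRρ s)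

theorem norm_value_le {n : ℕ} {C R ρ : ℝ} {H : FormalSeries n} (hH : GeomBound C R H)
    (hρ : 0 < ρ) (hR : 0 ≤ R) (hRρ : R * ρ ≤ 1 / 2) {z : Fin n ⊕ Fin n → ℂ}
    (hz : z ∈ polydisk n ρ) : ‖value H z‖ ≤ 2 * C :=
  (norm_tsum_le_tsum_norm (summable_norm_term hH hρ hR hRρ hz)).trans
    ((summable_norm_term hH hρ hR hRρ hz).tsum_le_of_sum_le fun s =>
      (Finset.sum_le_sum fun k _ => norm_term_le H hz k).trans
        (sum_norm_coeff_mul_pow_le hH hρ hR hRρ s))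

theorem GeomBound.mem_boundedAnalytic {n : ℕ} {C R ρ : ℝ} {H : FormalSeries n}
    (hH : GeomBound C R H) (hρ : 0 < ρ) (hR : 0 ≤ R) (hRρ : R * ρ ≤ 1 / 2) :
    H ∈ boundedAnalytic n ρ := by
  refine ⟨fun z hz => (summable_norm_term hH hρ hR hRρ hz).of_norm, 2 * C, ?_⟩
  rintro _ ⟨z, hz, rfl⟩
  exact norm_value_le hH hρ hR hRρ hz

theorem GeomBound.supNorm_le {n : ℕ} {C R ρ : ℝ} {H : FormalSeries n}
    (hH : GeomBound C R H) (hρ : 0 < ρ) (hR : 0 ≤ R) (hRρ : R * ρ ≤ 1 / 2) :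
    supNorm ρ H ≤ 2 * C := by
  have hC : 0 ≤ C := by simpa using (homNorm_nonneg 0 H).trans (hH 0)
  refine Real.sSup_le ?_ (by positivity)
  rintro _ ⟨z, hz, rfl⟩
  exact norm_value_le hH hρ hR hRρ hz

theorem supNorm_nonneg {n : ℕ} (ρ : ℝ) (H : FormalSeries n) : 0 ≤ supNorm ρ H := by
  refine Real.sSup_nonneg ?_
  rintro _ ⟨z, _, rfl⟩
  exact norm_nonneg _

theorem homNorm_smul {n : ℕ} (d : ℕ) (a : ℂ) (F : FormalSeries n) :
    homNorm d (a • F) = ‖a‖ * homNorm d F := by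
  simp [homNorm, Finset.mul_sum]

theorem GeomBound.smul {n : ℕ} {C R : ℝ} {H : FormalSeries n} (hH : GeomBound C R H) (a : ℂ) :
    GeomBound (‖a‖ * C) R (a • H) := by
  intro d
  rw [homNorm_smul, mul_assoc]
  exact mul_le_mul_of_nonneg_left (hH d) (norm_nonneg _)

/-! ### A convolution algebra of weights -/

/-- The weight `(d + 1)⁻²`, whose convolution square is bounded by a multiple of itself. -/
def invSq (d : ℕ) : ℝ := 1 / ((d : ℝ) + 1) ^ 2

theorem invSq_pos (d : ℕ) : 0 < invSq d := by unfold invSq; positivity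

theorem sum_range_invSq_le (m : ℕ) : ∑ i ∈ range (m + 1), invSq i ≤ 2 - 1 / ((m : ℝ) + 1) := by
  induction m with
  | zero => norm_num [invSq]
  | succ m ih =>
    rw [Finset.sum_range_succ]
    have h : invSq (m + 1) ≤ 1 / ((m : ℝ) + 1) - 1 / ((m + 1 : ℕ) + 1 : ℝ) := by
      unfold invSq
      push_cast
      rw [div_sub_div _ _ (by positivity) (by positivity), div_le_div_iff₀ (by positivity)
        (by positivity)]
      have : (0 : ℝ) ≤ m := Nat.cast_nonneg m
      nlinarith
    linarith

/-- From `(x+y+1)² ≤ 2((x+1)² + (y+1)²)`, a product of weights is at most `2 invSq d` times their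
sum, and each weight sums to at most 2. The constant, unlike that of `GeomBound.mul`, leaves the
radius untouched. -/
theorem sum_antidiagonal_invSq_le (d : ℕ) :
    ∑ p ∈ antidiagonal d, invSq p.1 * invSq p.2 ≤ 8 * invSq d := by
  have h1 : ∀ p ∈ antidiagonal d, invSq p.1 * invSq p.2 ≤
      2 * invSq d * (invSq p.1 + invSq p.2) := by
    intro p hp
    rw [HasAntidiagonal.mem_antidiagonal] at hp
    have hd : (d : ℝ) = p.1 + p.2 := by rw [← hp]; push_cast; rfl
    have hx : (0 : ℝ) ≤ p.1 := Nat.cast_nonneg _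
    have hy : (0 : ℝ) ≤ p.2 := Nat.cast_nonneg _
    unfold invSq
    rw [hd]
    generalize (p.1 : ℝ) = x at *
    generalize (p.2 : ℝ) = y at *
    rw [div_add_div _ _ (by positivity) (by positivity), div_mul_div_comm, mul_one_div,
      div_mul_div_comm, div_le_div_iff₀ (by positivity) (by positivity)]
    have : (x + y + 1) ^ 2 ≤ 2 * ((x + 1) ^ 2 + (y + 1) ^ 2) := by nlinarith [sq_nonneg (x - y)]
    have h3 : 0 ≤ (x + 1) ^ 2 * (y + 1) ^ 2 := by positivity
    nlinarith [mul_le_mul_of_nonneg_left this h3]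
  refine (Finset.sum_le_sum h1).trans ?_
  rw [← Finset.mul_sum, Finset.sum_add_distrib]
  have h2 : ∑ p ∈ antidiagonal d, invSq p.1 ≤ 2 := by
    rw [Finset.Nat.sum_antidiagonal_eq_sum_range_succ_mk]
    refine (sum_range_invSq_le d).trans ?_
    have : (0 : ℝ) ≤ 1 / ((d : ℝ) + 1) := by positivity
    linarith
  have h3 : ∑ p ∈ antidiagonal d, invSq p.2 ≤ 2 := by
    rw [← Finset.Nat.sum_antidiagonal_swap]; simpa using h2
  nlinarith [invSq_pos d]

/-- The homogeneous components are bounded by `α S ^ d (d + 1)⁻²`. -/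
def WeightBound {n : ℕ} (α S : ℝ) (H : FormalSeries n) : Prop :=
  ∀ d, homNorm d H ≤ α * (S ^ d * invSq d)

/-- The homogeneous components of the Euler derivative are bounded by `α S ^ d (d + 1)⁻²`. -/
def EulerBound {n : ℕ} (α S : ℝ) (H : FormalSeries n) : Prop :=
  ∀ d : ℕ, d * homNorm d H ≤ α * (S ^ d * invSq d)

theorem sum_antidiagonal_le {d : ℕ} {f g : ℕ → ℝ} {α β S : ℝ} (hS : 0 ≤ S) (hα : 0 ≤ α)
    (hβ : 0 ≤ β) (hg0 : ∀ d, 0 ≤ g d)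
    (hf : ∀ d, f d ≤ α * (S ^ d * invSq d)) (hg : ∀ d, g d ≤ β * (S ^ d * invSq d)) :
    ∑ p ∈ antidiagonal d, f p.1 * g p.2 ≤ 8 * α * β * (S ^ d * invSq d) := by
  have h1 : ∀ p ∈ antidiagonal d, f p.1 * g p.2 ≤
      α * β * S ^ d * (invSq p.1 * invSq p.2) := by
    intro p hp
    have := (invSq_pos p.1).le
    calc _ ≤ (α * (S ^ p.1 * invSq p.1)) * (β * (S ^ p.2 * invSq p.2)) :=
          mul_le_mul (hf _) (hg _) (hg0 _) (by positivity)
      _ = α * β * S ^ (p.1 + p.2) * (invSq p.1 * invSq p.2) := by ring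
      _ = _ := by rw [HasAntidiagonal.mem_antidiagonal.1 hp]
  refine (Finset.sum_le_sum h1).trans ?_
  rw [← Finset.mul_sum]
  calc _ ≤ α * β * S ^ d * (8 * invSq d) := by gcongr; exact sum_antidiagonal_invSq_le d
    _ = _ := by ring

theorem WeightBound.mul {n : ℕ} {α β S : ℝ} {F G : FormalSeries n} (hS : 0 ≤ S) (hα : 0 ≤ α)
    (hβ : 0 ≤ β) (hF : WeightBound α S F) (hG : WeightBound β S G) :
    WeightBound (8 * α * β) S (F * G) := fun d =>
  (homNorm_mul_le d F G).trans
    (sum_antidiagonal_le (f := fun i => homNorm i F) (g := fun j => homNorm j G) hS hα hβ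
      (fun _ => homNorm_nonneg _ _) hF hG)

/-- Leibniz rule: on the antidiagonal, `d` splits as `p.1 + p.2`. -/
theorem EulerBound.mul {n : ℕ} {α α' β β' S : ℝ} {F G : FormalSeries n} (hS : 0 ≤ S) (hα : 0 ≤ α)
    (hβ : 0 ≤ β) (hα' : 0 ≤ α') (hβ' : 0 ≤ β') (hF : WeightBound α S F) (hG : WeightBound β S G)
    (hF' : EulerBound α' S F) (hG' : EulerBound β' S G) :
    EulerBound (8 * (α' * β + α * β')) S (F * G) := by
  intro d
  have h1 : d * homNorm d (F * G) ≤
      ∑ p ∈ antidiagonal d, (p.1 * homNorm p.1 F) * homNorm p.2 G +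
        ∑ p ∈ antidiagonal d, homNorm p.1 F * (p.2 * homNorm p.2 G) := by
    refine (mul_le_mul_of_nonneg_left (homNorm_mul_le d F G) (Nat.cast_nonneg d)).trans
      (le_of_eq ?_)
    rw [Finset.mul_sum, ← Finset.sum_add_distrib]
    refine Finset.sum_congr rfl fun p hp => ?_
    rw [← HasAntidiagonal.mem_antidiagonal.1 hp]
    push_cast
    ring
  have h2 := sum_antidiagonal_le (d := d) (f := fun i => (i : ℝ) * homNorm i F)
    (g := fun j => homNorm j G) hS hα' hβ (fun _ => homNorm_nonneg _ _) hF' hG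
  have h3 := sum_antidiagonal_le (d := d) (f := fun i => homNorm i F)
    (g := fun j => (j : ℝ) * homNorm j G) hS hα hβ'
    (fun _ => mul_nonneg (Nat.cast_nonneg _) (homNorm_nonneg _ _)) hF hG'
  refine h1.trans ((add_le_add h2 h3).trans (le_of_eq ?_))
  ring

/-! ### Time-dependent majorants -/

/-- The growth factor of the reciprocal radius of convergence. -/
def dilation (c t : ℝ) : ℝ := 2 - Real.exp (-(c * t))

theorem one_le_dilation {c t : ℝ} (hc : 0 ≤ c) (ht : 0 ≤ t) : 1 ≤ dilation c t := by
  have : Real.exp (-(c * t)) ≤ 1 := Real.exp_le_one_iff.2 (by nlinarith)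
  unfold dilation; linarith

theorem dilation_le_two (c t : ℝ) : dilation c t ≤ 2 := by
  unfold dilation; linarith [Real.exp_pos (-(c * t))]

theorem hasDerivAt_exp_neg_mul (c t : ℝ) :
    HasDerivAt (fun t => Real.exp (-(c * t))) (Real.exp (-(c * t)) * -c) t := by
  have h : HasDerivAt (fun t => -(c * t)) (-(c * 1)) t := ((hasDerivAt_id t).const_mul c).neg
  exact h.exp.congr_deriv (by ring)

theorem hasDerivAt_dilation (c t : ℝ) :
    HasDerivAt (dilation c) (c * Real.exp (-(c * t))) t := by
  refine ((hasDerivAt_exp_neg_mul c t).const_sub 2).congr_deriv ?_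
  ring

/-- The majorant of the degree `d` component of the multiplier `U`. -/
def multiplierMajorant (R c : ℝ) (d : ℕ) (t : ℝ) : ℝ :=
  (R * dilation c t) ^ d * (invSq d * (Real.exp (c * t) / (1 + d * Real.exp (-(c * t)))))

/-- The majorant of the degree `d` component of the averaged part `N⁰`. -/
def averageMajorant (A R c : ℝ) (d : ℕ) (t : ℝ) : ℝ :=
  A * (R ^ d * invSq d) / (d + 1) * dilation c t ^ (d + 1)

/-- The bound on the rate of `N⁰` is an exact derivative because `c e^{-ct}` is the derivative of
the dilation; the gain is the denominator `d + 1`. -/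
theorem hasDerivAt_averageMajorant (A R c : ℝ) (d : ℕ) (t : ℝ) :
    HasDerivAt (averageMajorant A R c d)
      (A * ((R * dilation c t) ^ d * invSq d) * (c * Real.exp (-(c * t)))) t := by
  have h := ((hasDerivAt_dilation c t).pow (d + 1)).const_mul (A * (R ^ d * invSq d) / (d + 1))
  refine h.congr_deriv ?_
  rw [mul_pow]
  have : (d : ℝ) + 1 ≠ 0 := by positivity
  push_cast
  field_simp

/-- With `e = e^{-ct}`, the logarithmic derivative is at least `c` from the quotient plus `c d e /
2` from the dilation. Their sum `(c/2)(2 + d e)` cancels the denominator `1 + d e`. -/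
theorem exists_hasDerivAt_multiplierMajorant {R c t : ℝ} (hR : 0 ≤ R) (hc : 0 ≤ c) (ht : 0 ≤ t)
    (d : ℕ) : ∃ u', HasDerivAt (multiplierMajorant R c d) u' t ∧
      c / 2 * Real.exp (c * t) * ((R * dilation c t) ^ d * invSq d) ≤ u' := by
  have hl := hasDerivAt_dilation c t
  have h1 := (hl.const_mul R).pow d
  have h2 : HasDerivAt (fun t => Real.exp (c * t)) (Real.exp (c * t) * c) t := by
    simpa using ((hasDerivAt_id t).const_mul c).exp
  have h3 : HasDerivAt (fun t => 1 + d * Real.exp (-(c * t)))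
      (d * (Real.exp (-(c * t)) * -c)) t :=
    ((hasDerivAt_exp_neg_mul c t).const_mul (d : ℝ)).const_add 1
  have hden : 0 < 1 + (d : ℝ) * Real.exp (-(c * t)) := by positivity
  have h4 := h1.mul ((h2.div h3 hden.ne').const_mul (invSq d))
  refine ⟨_, h4, ?_⟩
  have hl1 := one_le_dilation hc ht
  have hl2 := dilation_le_two c t
  set l := dilation c t
  set E := Real.exp (c * t) with hE
  have hEpos : 0 < E := Real.exp_pos _
  set e := Real.exp (-(c * t)) with he
  have hepos : 0 < e := Real.exp_pos _
  have hb := (invSq_pos d).le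
  have h5 : c * (E / (1 + d * e)) ≤ (E * c * (1 + d * e) - E * (d * (e * -c))) / (1 + d * e) ^ 2 := by
    rw [le_div_iff₀ (by positivity)]
    have : c * (E / (1 + d * e)) * (1 + d * e) ^ 2 = c * E * (1 + d * e) := by field_simp
    rw [this]
    have : 0 ≤ E * (d * (e * c)) := by positivity
    linarith
  -- Here `l ≤ 2` is used to restore the missing factor `R l`, at the price of `1/2`.
  have h6 : (R * l) ^ d * (d * (c * e / 2)) ≤ d * (R * l) ^ (d - 1) * (R * (c * e)) := by
    rcases d with _ | m
    · simp
    · rw [Nat.add_sub_cancel, pow_succ]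
      push_cast
      have : 0 ≤ (R * l) ^ m * (R * (m + 1) * c * e) := by positivity
      nlinarith
  calc c / 2 * E * ((R * l) ^ d * invSq d)
      ≤ (R * l) ^ d * (d * (c * e / 2)) * (invSq d * (E / (1 + d * e)))
        + (R * l) ^ d * (invSq d * (c * (E / (1 + d * e)))) := by
        have : (R * l) ^ d * (d * (c * e / 2)) * (invSq d * (E / (1 + d * e)))
            + (R * l) ^ d * (invSq d * (c * (E / (1 + d * e))))
            = c / 2 * E * ((R * l) ^ d * invSq d) * ((2 + d * e) / (1 + d * e)) := by
          field_simp
          ring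
        rw [this]
        refine le_mul_of_one_le_right (by positivity) ?_
        rw [one_le_div hden]
        linarith
    _ ≤ _ := by
        simp only [Pi.div_apply, Pi.pow_apply]
        gcongr

theorem weightBound_of_multiplierMajorant {n : ℕ} {R c t : ℝ} {U : FormalSeries n} (hR : 0 ≤ R)
    (hc : 0 ≤ c) (ht : 0 ≤ t) (hU : ∀ d, homNorm d U ≤ multiplierMajorant R c d t) :
    WeightBound (Real.exp (c * t)) (R * dilation c t) U := by
  intro d
  refine (hU d).trans ?_
  have := (invSq_pos d).le
  have hl := one_le_dilation hc ht
  have h1 : Real.exp (c * t) / (1 + d * Real.exp (-(c * t))) ≤ Real.exp (c * t) :=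
    div_le_self (Real.exp_pos _).le (le_add_of_nonneg_right (by positivity))
  calc multiplierMajorant R c d t
      ≤ (R * dilation c t) ^ d * (invSq d * Real.exp (c * t)) := by
        unfold multiplierMajorant; gcongr
    _ = _ := by ring

/-- The denominator `1 + d e^{-ct}` trades the factor `d` for one more `e^{ct}`, uniformly in `d`.
-/
theorem eulerBound_of_multiplierMajorant {n : ℕ} {R c t : ℝ} {U : FormalSeries n} (hR : 0 ≤ R)
    (hc : 0 ≤ c) (ht : 0 ≤ t) (hU : ∀ d, homNorm d U ≤ multiplierMajorant R c d t) :
    EulerBound (Real.exp (c * t) ^ 2) (R * dilation c t) U := by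
  intro d
  have := (invSq_pos d).le
  have hl := one_le_dilation hc ht
  have hE := Real.exp_pos (c * t)
  have h1 : d * (Real.exp (c * t) / (1 + d * Real.exp (-(c * t)))) ≤ Real.exp (c * t) ^ 2 := by
    rw [mul_div_assoc', div_le_iff₀ (by positivity), Real.exp_neg]
    have : Real.exp (c * t) ^ 2 * (1 + d * (Real.exp (c * t))⁻¹)
        = Real.exp (c * t) ^ 2 + d * Real.exp (c * t) := by field_simp
    rw [this]
    linarith [sq_nonneg (Real.exp (c * t))]
  calc d * homNorm d U ≤ d * multiplierMajorant R c d t := by gcongr; exact hU d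
    _ = (R * dilation c t) ^ d * (invSq d *
        (d * (Real.exp (c * t) / (1 + d * Real.exp (-(c * t)))))) := by
        unfold multiplierMajorant; ring
    _ ≤ (R * dilation c t) ^ d * (invSq d * Real.exp (c * t) ^ 2) := by gcongr
    _ = _ := by ring

theorem homNorm_one_le {n : ℕ} {R c t : ℝ} (hR : 0 ≤ R) (hc : 0 ≤ c) (ht : 0 ≤ t) (d : ℕ) :
    homNorm d (1 : FormalSeries n) ≤ multiplierMajorant R c d t := by
  classical
  rcases d with _ | d
  · have h1 : homNorm 0 (1 : FormalSeries n) = 1 := by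
      have : degreeIndices n 0 = {0} := by 
        ext k
        rw [mem_degreeIndices, Finset.mem_singleton]
        exact Finsupp.degree_eq_zero_iff k
      simp [homNorm, this]
    rw [h1]
    simpa [multiplierMajorant, invSq] using mul_nonneg hc ht
  · have h1 : homNorm (d + 1) (1 : FormalSeries n) = 0 := by
      refine Finset.sum_eq_zero fun k hk => ?_
      rw [mem_degreeIndices] at hk
      have : k ≠ 0 := by rintro rfl; simp at hk
      rw [coeff_one, if_neg this, norm_zero]
    rw [h1]
    have := (invSq_pos (d + 1)).le
    have hl := one_le_dilation hc ht
    unfold multiplierMajorant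
    positivity

/-! ### Curves of formal series with continuous coefficients -/

/-- All Taylor coefficients of the curve are continuous. -/
def ContCoeff {n : ℕ} (γ : ℝ → FormalSeries n) : Prop := ∀ k, Continuous fun t => coeff k (γ t)

/-- The coefficientwise primitive of a curve, vanishing at `0`. -/
def primitive {n : ℕ} (γ : ℝ → FormalSeries n) (t : ℝ) : FormalSeries n :=
  fun k => ∫ s in (0 : ℝ)..t, coeff k (γ s)

theorem coeff_primitive {n : ℕ} (γ : ℝ → FormalSeries n) (t : ℝ) (k : MultiIndex n) :
    coeff k (primitive γ t) = ∫ s in (0 : ℝ)..t, coeff k (γ s) := rfl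

theorem primitive_zero {n : ℕ} (γ : ℝ → FormalSeries n) : primitive γ 0 = 0 := by
  ext k
  simp [coeff_primitive]

theorem contCoeff_const {n : ℕ} (H : FormalSeries n) : ContCoeff fun _ => H :=
  fun _ => continuous_const

theorem ContCoeff.mul {n : ℕ} {γ η : ℝ → FormalSeries n} (hγ : ContCoeff γ) (hη : ContCoeff η) :
    ContCoeff fun t => γ t * η t := by
  classical
  intro k
  simp only [coeff_mul]
  exact continuous_finsetSum _ fun p _ => (hγ p.1).mul (hη p.2)

theorem ContCoeff.sub {n : ℕ} {γ η : ℝ → FormalSeries n} (hγ : ContCoeff γ) (hη : ContCoeff η) :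
    ContCoeff fun t => γ t - η t := by
  intro k
  simp only [map_sub]
  exact (hγ k).sub (hη k)

theorem ContCoeff.smul {n : ℕ} {γ : ℝ → FormalSeries n} {f : ℝ → ℂ} (hf : Continuous f)
    (hγ : ContCoeff γ) : ContCoeff fun t => f t • γ t := by
  intro k
  simp only [map_smul, smul_eq_mul]
  exact hf.mul (hγ k)

theorem ContCoeff.dirDeriv {n : ℕ} (q : Fin n → ℤ) {γ : ℝ → FormalSeries n} (hγ : ContCoeff γ) :
    ContCoeff fun t => dirDeriv q (γ t) := by
  intro k
  simp only [coeff_dirDeriv]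
  exact continuous_finsetSum _ fun j _ => continuous_const.mul (continuous_const.mul (hγ _))

theorem ContCoeff.hasDerivAt_primitive {n : ℕ} {γ : ℝ → FormalSeries n} (hγ : ContCoeff γ)
    (k : MultiIndex n) (t : ℝ) :
    HasDerivAt (fun t => coeff k (primitive γ t)) (coeff k (γ t)) t :=
  intervalIntegral.integral_hasDerivAt_right ((hγ k).intervalIntegrable _ _)
    ((hγ k).stronglyMeasurableAtFilter _ _) (hγ k).continuousAt

theorem ContCoeff.primitive {n : ℕ} {γ : ℝ → FormalSeries n} (hγ : ContCoeff γ) :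
    ContCoeff (primitive γ) := fun k =>
  continuous_iff_continuousAt.2 fun t => (hγ.hasDerivAt_primitive k t).continuousAt

theorem ContCoeff.homNorm {n : ℕ} {γ : ℝ → FormalSeries n} (hγ : ContCoeff γ) (d : ℕ) :
    Continuous fun t => homNorm d (γ t) :=
  continuous_finsetSum _ fun k _ => (hγ k).norm

theorem homNorm_sub_le {n : ℕ} (d : ℕ) (F G : FormalSeries n) :
    homNorm d (F - G) ≤ homNorm d F + homNorm d G := by
  unfold homNorm
  rw [← Finset.sum_add_distrib]
  refine Finset.sum_le_sum fun k _ => ?_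
  rw [map_sub]
  exact norm_sub_le _ _

/-- Mean value inequality for the homogeneous components of a primitive. -/
theorem ContCoeff.homNorm_primitive_sub_le {n d : ℕ} {γ : ℝ → FormalSeries n} (hγ : ContCoeff γ)
    {g g' : ℝ → ℝ} {a t : ℝ} (hat : a ≤ t) (hg : ∀ s, a ≤ s → HasDerivAt g (g' s) s)
    (h : ∀ s, a ≤ s → NormalizationFlow.homNorm d (γ s) ≤ g' s) :
    NormalizationFlow.homNorm d (NormalizationFlow.primitive γ t - NormalizationFlow.primitive γ a)
      ≤ g t - g a := by
  have h1 : ∀ k, ‖coeff k (NormalizationFlow.primitive γ t - NormalizationFlow.primitive γ a)‖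
      ≤ ∫ s in a..t, ‖coeff k (γ s)‖ := by
    intro k
    rw [map_sub, coeff_primitive, coeff_primitive, intervalIntegral.integral_interval_sub_left
      ((hγ k).intervalIntegrable _ _) ((hγ k).intervalIntegrable _ _)]
    exact intervalIntegral.norm_integral_le_integral_norm hat
  refine (Finset.sum_le_sum fun k _ => h1 k).trans ?_
  rw [← intervalIntegral.integral_finsetSum fun k _ => (hγ k).norm.intervalIntegrable _ _]
  exact intervalIntegral.integral_le_sub_of_hasDeriv_right_of_le hat
    (fun s hs => (hg s hs.1).continuousAt.continuousWithinAt)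
    (fun s hs => (hg s hs.1.le).hasDerivWithinAt)
    ((hγ.homNorm d).integrableOn_Icc) (fun s hs => h s hs.1.le)

/-! ### Stability of normal forms and of vanishing orders under linear operations and integration.
-/

theorem sub_mem_normalForms {n : ℕ} {F G : FormalSeries n} (hF : F ∈ normalForms n)
    (hG : G ∈ normalForms n) : F - G ∈ normalForms n := by
  intro k hk j
  by_cases h : coeff k F = 0
  · refine hG k (fun h' => hk ?_) j
    rw [map_sub, h, h', sub_zero]
  · exact hF k h j

theorem smul_mem_normalForms {n : ℕ} (a : ℂ) {F : FormalSeries n} (hF : F ∈ normalForms n) :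
    a • F ∈ normalForms n := by
  intro k hk j
  refine hF k (fun h => hk ?_) j
  rw [map_smul, h, smul_zero]

theorem primitive_mem_normalForms {n : ℕ} {γ : ℝ → FormalSeries n}
    (hγ : ∀ t, γ t ∈ normalForms n) (t : ℝ) : primitive γ t ∈ normalForms n := by
  intro k hk
  by_contra h
  refine hk ?_
  rw [coeff_primitive]
  have : ∀ s, coeff k (γ s) = 0 := fun s => by
    by_contra h0
    exact h (hγ s k h0)
  simp [this]

theorem isOrder_zero {n : ℕ} (F : FormalSeries n) : IsOrder 0 F := fun _ hk =>
  absurd hk (Nat.not_lt_zero _)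

theorem IsOrder.mono {n a b : ℕ} {F : FormalSeries n} (hF : IsOrder b F) (h : a ≤ b) :
    IsOrder a F := fun k hk => hF k (hk.trans_le h)

theorem IsOrder.sub {n a : ℕ} {F G : FormalSeries n} (hF : IsOrder a F) (hG : IsOrder a G) :
    IsOrder a (F - G) := fun k hk => by rw [map_sub, hF k hk, hG k hk, sub_zero]

theorem IsOrder.add {n a : ℕ} {F G : FormalSeries n} (hF : IsOrder a F) (hG : IsOrder a G) :
    IsOrder a (F + G) := fun k hk => by rw [map_add, hF k hk, hG k hk, zero_add]

theorem IsOrder.smul {n a : ℕ} {F : FormalSeries n} (c : ℂ) (hF : IsOrder a F) :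
    IsOrder a (c • F) := fun k hk => by rw [map_smul, hF k hk, smul_zero]

theorem isOrder_primitive {n a : ℕ} {γ : ℝ → FormalSeries n} (hγ : ∀ s, IsOrder a (γ s)) (t : ℝ) :
    IsOrder a (primitive γ t) := fun k hk => by
  rw [coeff_primitive]
  simp [fun s => hγ s k hk]

theorem isOrder_primitive_sub {n a : ℕ} {γ η : ℝ → FormalSeries n}
    (h : ∀ s, IsOrder a (γ s - η s)) (t : ℝ) :
    IsOrder a (primitive γ t - primitive η t) := fun k hk => by
  have : ∀ s, coeff k (γ s) = coeff k (η s) := fun s => by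
    have := h s k hk
    rwa [map_sub, sub_eq_zero] at this
  rw [map_sub, coeff_primitive, coeff_primitive]
  simp [this]

theorem dirDeriv_sub {n : ℕ} (q : Fin n → ℤ) (F G : FormalSeries n) :
    dirDeriv q (F - G) = dirDeriv q F - dirDeriv q G := by
  ext k
  simp only [coeff_dirDeriv, map_sub, mul_sub, Finset.sum_sub_distrib]

/-! ### The Picard operator -/

section Picard

variable {n : ℕ} (w : ℝ) (q : Fin n → ℤ) (P M : FormalSeries n)

/-- The rate of decrease of `N⁰` for `N^{±q} = U N^{±q}(0)`, where `P = κ^{[q]} N^{-q}(0) N^q(0)`. -/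
def averageRate (U : ℝ → FormalSeries n) (s : ℝ) : FormalSeries n :=
  ((2 * Real.exp (-2 * w * s) : ℝ) : ℂ) • dirDeriv q (P * U s * U s)

/-- The averaged part `N⁰` with initial value `M` determined by the multiplier `U`. -/
def averagePart (U : ℝ → FormalSeries n) (t : ℝ) : FormalSeries n :=
  M - primitive (averageRate w q P U) t

/-- The Picard operator of the equation `∂U = -U ⟨q,∂⟩N⁰`, `U(0) = 1`. -/
def picard (U : ℝ → FormalSeries n) (t : ℝ) : FormalSeries n :=
  1 - primitive (fun s => U s * dirDeriv q (averagePart w q P M U s)) t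

variable {P M}

theorem ContCoeff.averageRate {U : ℝ → FormalSeries n} (hU : ContCoeff U) :
    ContCoeff (averageRate w q P U) :=
  ContCoeff.smul (by fun_prop) ((((contCoeff_const P).mul hU).mul hU).dirDeriv q)

theorem ContCoeff.averagePart {U : ℝ → FormalSeries n} (hU : ContCoeff U) :
    ContCoeff (averagePart w q P M U) :=
  (contCoeff_const M).sub (hU.averageRate w q).primitive

theorem ContCoeff.picard {U : ℝ → FormalSeries n} (hU : ContCoeff U) :
    ContCoeff (picard w q P M U) :=
  (contCoeff_const 1).sub (hU.mul ((hU.averagePart w q).dirDeriv q)).primitive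

theorem averageRate_mem_normalForms (hP : P ∈ normalForms n) {U : ℝ → FormalSeries n}
    (hU : ∀ t, U t ∈ normalForms n) (t : ℝ) : averageRate w q P U t ∈ normalForms n :=
  smul_mem_normalForms _ (dirDeriv_mem_normalForms q
    (mul_mem_normalForms (mul_mem_normalForms hP (hU t)) (hU t)))

theorem averagePart_mem_normalForms (hP : P ∈ normalForms n) (hM : M ∈ normalForms n)
    {U : ℝ → FormalSeries n} (hU : ∀ t, U t ∈ normalForms n) (t : ℝ) :
    averagePart w q P M U t ∈ normalForms n :=
  sub_mem_normalForms hM (primitive_mem_normalForms (averageRate_mem_normalForms w q hP hU) t)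

theorem picard_mem_normalForms (hP : P ∈ normalForms n) (hM : M ∈ normalForms n)
    {U : ℝ → FormalSeries n} (hU : ∀ t, U t ∈ normalForms n) (t : ℝ) :
    picard w q P M U t ∈ normalForms n :=
  sub_mem_normalForms (one_mem_normalForms n) (primitive_mem_normalForms
    (fun s => mul_mem_normalForms (hU s) (dirDeriv_mem_normalForms q
      (averagePart_mem_normalForms w q hP hM hU s))) t)

theorem isOrder_averagePart (hP : IsOrder 6 P) (hM : IsOrder 4 M) (U : ℝ → FormalSeries n)
    (t : ℝ) : IsOrder 4 (averagePart w q P M U t) :=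
  hM.sub (isOrder_primitive (fun s =>
    (IsOrder.dirDeriv q (a := 4)
      ((hP.mul (isOrder_zero (U s))).mul (isOrder_zero (U s)))).smul _) t)

theorem isOrder_averagePart_sub (hP : IsOrder 6 P) {a : ℕ} {U V : ℝ → FormalSeries n}
    (h : ∀ t, IsOrder a (U t - V t)) (t : ℝ) :
    IsOrder (a + 4) (averagePart w q P M U t - averagePart w q P M V t) := by
  have h1 : ∀ s, IsOrder (a + 4) (averageRate w q P V s - averageRate w q P U s) := by
    intro s
    -- `V² - U² = (U - V)(-U - V)` exposes the factor of order `a`.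
    have h2 : averageRate w q P V s - averageRate w q P U s
        = ((2 * Real.exp (-2 * w * s) : ℝ) : ℂ) •
          dirDeriv q (P * (U s - V s) * (-(U s) - V s)) := by
      rw [averageRate, averageRate, ← smul_sub, ← dirDeriv_sub]
      congr 2
      ring
    rw [h2]
    exact (IsOrder.dirDeriv q (((hP.mul (h s)).mul (isOrder_zero _)).mono (by omega))).smul _
  have h3 := isOrder_primitive_sub h1 t
  rwa [averagePart, averagePart, sub_sub_sub_cancel_left]

/-- Contraction in the degree filtration: `⟨q,∂⟩N⁰` has order 2 and its variation has order `a + 2`.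
A gain of 1 suffices. -/
theorem isOrder_picard_sub (hP : IsOrder 6 P) (hM : IsOrder 4 M) {a : ℕ}
    {U V : ℝ → FormalSeries n} (h : ∀ t, IsOrder a (U t - V t)) (t : ℝ) :
    IsOrder (a + 1) (picard w q P M U t - picard w q P M V t) := by
  rw [picard, picard, sub_sub_sub_cancel_left]
  refine isOrder_primitive_sub (fun s => ?_) t
  have h2 : V s * dirDeriv q (averagePart w q P M V s) - U s * dirDeriv q (averagePart w q P M U s)
      = -U s * dirDeriv q (averagePart w q P M U s - averagePart w q P M V s)
        - (U s - V s) * dirDeriv q (averagePart w q P M V s) := by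
    rw [dirDeriv_sub]
    ring
  rw [h2]
  refine IsOrder.sub ?_ ?_
  · exact ((isOrder_zero _).mul (IsOrder.dirDeriv q
      ((isOrder_averagePart_sub w q hP h s).mono (a := a + 2 + 2) (by omega)))).mono (by omega)
  · exact ((h s).mul (IsOrder.dirDeriv q (isOrder_averagePart w q hP hM V s))).mono (by omega)

/-! ### The formal fixed point as a stable limit of Picard iterates. -/

variable (P M)

/-- The Picard iterates. -/
def iterate (i : ℕ) : ℝ → FormalSeries n := (picard w q P M)^[i] (fun _ => 1)

/-- The fixed point of the Picard operator. -/
def multiplier (t : ℝ) : FormalSeries n := fun k => coeff k (iterate w q P M (k.degree + 1) t)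

variable {P M}

theorem iterate_succ (i : ℕ) : iterate w q P M (i + 1) = picard w q P M (iterate w q P M i) :=
  Function.iterate_succ_apply' _ _ _

theorem isOrder_iterate_succ_sub (hP : IsOrder 6 P) (hM : IsOrder 4 M) (i : ℕ) (t : ℝ) :
    IsOrder i (iterate w q P M (i + 1) t - iterate w q P M i t) := by
  induction i generalizing t with
  | zero => exact isOrder_zero _
  | succ i ih =>
    rw [iterate_succ w q (i + 1)]
    nth_rewrite 2 [iterate_succ w q i]
    exact isOrder_picard_sub w q hP hM ih t

theorem isOrder_iterate_sub (hP : IsOrder 6 P) (hM : IsOrder 4 M) {i j : ℕ} (hij : i ≤ j)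
    (t : ℝ) : IsOrder i (iterate w q P M j t - iterate w q P M i t) := by
  induction j, hij using Nat.le_induction with
  | base => rw [sub_self]; exact fun k _ => map_zero _
  | succ j hj ih =>
    rw [← sub_add_sub_cancel _ (iterate w q P M j t)]
    exact ((isOrder_iterate_succ_sub w q hP hM j t).mono hj).add ih

/-- The `i`th iterate is final in degrees below `i`, hence the index `k.degree + 1` in `multiplier`.
-/
theorem isOrder_multiplier_sub (hP : IsOrder 6 P) (hM : IsOrder 4 M) (i : ℕ) (t : ℝ) :
    IsOrder i (multiplier w q P M t - iterate w q P M i t) := by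
  intro k hk
  have h := isOrder_iterate_sub w q hP hM (Nat.succ_le_of_lt hk) t k (Nat.lt_succ_self _)
  rw [map_sub, sub_eq_zero] at h ⊢
  exact h.symm

theorem picard_multiplier (hP : IsOrder 6 P) (hM : IsOrder 4 M) :
    picard w q P M (multiplier w q P M) = multiplier w q P M := by
  funext t
  ext k
  have h1 := isOrder_picard_sub w q hP hM (isOrder_multiplier_sub w q hP hM k.degree) t k
    (Nat.lt_succ_self _)
  have h2 := isOrder_multiplier_sub w q hP hM (k.degree + 1) t k (Nat.lt_succ_self _)
  rw [map_sub, sub_eq_zero] at h1 h2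
  rw [h1, h2, iterate_succ]

theorem contCoeff_iterate (i : ℕ) : ContCoeff (iterate w q P M i) := by
  induction i with
  | zero => exact contCoeff_const 1
  | succ i ih => rw [iterate_succ]; exact ih.picard w q

theorem contCoeff_multiplier : ContCoeff (multiplier w q P M) :=
  fun k => contCoeff_iterate w q (k.degree + 1) k

theorem iterate_mem_normalForms (hP : P ∈ normalForms n) (hM : M ∈ normalForms n) (i : ℕ) (t : ℝ) :
    iterate w q P M i t ∈ normalForms n := by
  induction i generalizing t with
  | zero => exact one_mem_normalForms n
  | succ i ih => rw [iterate_succ]; exact picard_mem_normalForms w q hP hM ih t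

theorem multiplier_mem_normalForms (hP : P ∈ normalForms n) (hM : M ∈ normalForms n) (t : ℝ) :
    multiplier w q P M t ∈ normalForms n :=
  fun k hk => iterate_mem_normalForms w q hP hM _ t k hk

theorem homNorm_multiplier (hP : IsOrder 6 P) (hM : IsOrder 4 M) (d : ℕ) (t : ℝ) :
    homNorm d (multiplier w q P M t) = homNorm d (iterate w q P M (d + 1) t) := by
  refine Finset.sum_congr rfl fun k hk => ?_
  have h := isOrder_multiplier_sub w q hP hM (d + 1) t k (by rw [mem_degreeIndices.1 hk]; omega)
  rw [map_sub, sub_eq_zero] at h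
  rw [h]

/-! ### A priori bounds -/

section Bounds

variable {c R A B : ℝ}

/-- The derivative of `P U²` is estimated by the Euler bound in degree `d + 2`. Only one factor is
differentiated at a time, so the growth is `E³` with `E = e^{cs}`, rather than a power of `d`. -/
theorem homNorm_averageRate_le (hc : 0 < c) (hR : 0 < R) (hB0 : 0 ≤ B)
    (hP : ∀ d : ℕ, (d + 1) * homNorm d P ≤ B * (R ^ d * invSq d))
    (hB : 1536 * dirSize q * B * R ^ 2 ≤ A * c) {U : ℝ → FormalSeries n} {s : ℝ} (hs : 0 ≤ s)
    (hU : ∀ d, homNorm d (U s) ≤ multiplierMajorant R c d s) (d : ℕ) :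
    homNorm d (averageRate (2 * c) q P U s) ≤
      A * ((R * dilation c s) ^ d * invSq d) * (c * Real.exp (-(c * s))) := by
  have hl1 := one_le_dilation hc.le hs
  have hl2 := dilation_le_two c s
  have hE1 : 1 ≤ Real.exp (c * s) := Real.one_le_exp (by positivity)
  have hUw := weightBound_of_multiplierMajorant hR.le hc.le hs hU
  have hUe := eulerBound_of_multiplierMajorant hR.le hc.le hs hU
  have hexp : Real.exp (-2 * (2 * c) * s) * Real.exp (c * s) ^ 3 = Real.exp (-(c * s)) := by
    rw [← Real.exp_nat_mul, ← Real.exp_add]; congr 1; push_cast; ring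
  have hQ := dirSize_pos q
  have hP1 : ∀ d : ℕ, (d + 1) * homNorm d P ≤ B * ((R * dilation c s) ^ d * invSq d) := by
    intro d
    refine (hP d).trans ?_
    have := (invSq_pos d).le
    gcongr
    exact le_mul_of_one_le_right hR.le hl1
  generalize hSdef : R * dilation c s = S at *
  have hS : 0 ≤ S := by rw [← hSdef]; positivity
  have hS2 : S ^ 2 ≤ 4 * R ^ 2 := by
    rw [← hSdef, mul_comm R]
    calc (dilation c s * R) ^ 2 ≤ (2 * R) ^ 2 := by gcongr
      _ = 4 * R ^ 2 := by ring
  generalize Real.exp (c * s) = E at *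
  have hPw : WeightBound B S P := fun d => by
    have := hP1 d
    have h0 : 0 ≤ d * homNorm d P := mul_nonneg (Nat.cast_nonneg _) (homNorm_nonneg _ _)
    linarith
  have hPe : EulerBound B S P := fun d => by
    have := hP1 d
    have h0 := homNorm_nonneg d P
    linarith
  have h1 := WeightBound.mul hS hB0 (by positivity) hPw hUw
  have h2 := EulerBound.mul hS hB0 (by positivity) hB0 (by positivity) hPw hUw hPe hUe
  have h3 := EulerBound.mul hS (by positivity) (by positivity) (by positivity) (by positivity)
    h1 hUw h2 hUe (d + 2)
  have hb := (invSq_pos (d + 2)).le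
  have hbd : invSq (d + 2) ≤ invSq d := by
    unfold invSq
    push_cast
    gcongr
    linarith
  have h4 : (d + 1) * homNorm (d + 2) (P * U s * U s) ≤
      192 * B * E ^ 3 * (4 * R ^ 2 * (S ^ d * invSq d)) := by
    -- Three Leibniz terms, each with the constant `8 · 8`; `E ≥ 1` raises the lower power. Then
    -- `1536 = 2 · 192 · 4`.
    have h5 : 8 * (8 * (B * E + B * E ^ 2) * E + 8 * B * E * E ^ 2) ≤ 192 * B * E ^ 3 := by
      have h6 : B * E ^ 2 * 1 ≤ B * E ^ 2 * E := by gcongr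
      nlinarith
    have h7 : S ^ (d + 2) * invSq (d + 2) ≤ 4 * R ^ 2 * (S ^ d * invSq d) := by
      calc S ^ (d + 2) * invSq (d + 2) = S ^ 2 * (S ^ d * invSq (d + 2)) := by ring
        _ ≤ _ := by gcongr
    have h0 := homNorm_nonneg (d + 2) (P * U s * U s)
    push_cast at h3
    calc _ ≤ ((d : ℝ) + 2) * homNorm (d + 2) (P * U s * U s) := by gcongr; norm_num
      _ ≤ _ := h3
      _ ≤ _ := by gcongr
  have hbd0 := (invSq_pos d).le
  rw [averageRate, homNorm_smul, Complex.norm_real, Real.norm_of_nonneg (by positivity)]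
  calc _ ≤ 2 * Real.exp (-2 * (2 * c) * s) *
        (dirSize q * ((d + 1) * homNorm (d + 2) (P * U s * U s))) := by
        gcongr
        rw [← mul_assoc]
        exact homNorm_dirDeriv_le q d _
    _ ≤ 2 * Real.exp (-2 * (2 * c) * s) *
        (dirSize q * (192 * B * E ^ 3 * (4 * R ^ 2 * (S ^ d * invSq d)))) := by gcongr
    _ = (1536 * dirSize q * B * R ^ 2) * (S ^ d * invSq d) *
        (Real.exp (-2 * (2 * c) * s) * E ^ 3) := by ring
    _ ≤ (A * c) * (S ^ d * invSq d) * (Real.exp (-2 * (2 * c) * s) * E ^ 3) := by gcongr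
    _ = _ := by rw [hexp]; ring

/-- The conditions under which the majorants are preserved by the Picard operator. -/
structure Admissible (q : Fin n → ℤ) (P M : FormalSeries n) (c R A B : ℝ) : Prop where
  c_pos : 0 < c
  R_pos : 0 < R
  A_nonneg : 0 ≤ A
  B_nonneg : 0 ≤ B
  -- The factor `d + 1` yields both a weight and an Euler bound for `P`; for `M` it matches
  -- `averageMajorant` at time 0.
  bound_P : ∀ d : ℕ, (d + 1) * homNorm d P ≤ B * (R ^ d * invSq d)
  bound_M : ∀ d : ℕ, (d + 1) * homNorm d M ≤ A * (R ^ d * invSq d)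
  -- The 8 bounds the cube of the dilation. After the convolution constant 8, `c / 16` becomes the
  -- tolerated rate `c / 2`.
  small_A : 8 * dirSize q * A * R ^ 2 ≤ c / 16
  small_B : 1536 * dirSize q * B * R ^ 2 ≤ A * c

variable {q}

theorem Admissible.homNorm_averagePart_sub_le (h : Admissible q P M c R A B)
    {U : ℝ → FormalSeries n} (hUc : ContCoeff U)
    (hU : ∀ s, 0 ≤ s → ∀ d, homNorm d (U s) ≤ multiplierMajorant R c d s) {a t : ℝ} (ha : 0 ≤ a)
    (hat : a ≤ t) (d : ℕ) :
    homNorm d (averagePart (2 * c) q P M U a - averagePart (2 * c) q P M U t) ≤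
      averageMajorant A R c d t - averageMajorant A R c d a := by
  rw [averagePart, averagePart, sub_sub_sub_cancel_left]
  exact (hUc.averageRate _ q).homNorm_primitive_sub_le hat
    (fun s _ => hasDerivAt_averageMajorant A R c d s)
    (fun s hs => homNorm_averageRate_le q h.c_pos h.R_pos h.B_nonneg h.bound_P h.small_B
      (ha.trans hs) (hU s (ha.trans hs)) d)

theorem Admissible.homNorm_averagePart_le (h : Admissible q P M c R A B)
    {U : ℝ → FormalSeries n} (hUc : ContCoeff U)
    (hU : ∀ s, 0 ≤ s → ∀ d, homNorm d (U s) ≤ multiplierMajorant R c d s) {t : ℝ} (ht : 0 ≤ t)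
    (d : ℕ) : homNorm d (averagePart (2 * c) q P M U t) ≤ averageMajorant A R c d t := by
  have h1 := h.homNorm_averagePart_sub_le hUc hU le_rfl ht d
  have h2 : averagePart (2 * c) q P M U 0 = M := by rw [averagePart, primitive_zero, sub_zero]
  have h3 : homNorm d M ≤ averageMajorant A R c d 0 := by
    have := h.bound_M d
    rw [averageMajorant, dilation, mul_zero, neg_zero, Real.exp_zero]
    norm_num
    rw [le_div_iff₀ (by positivity)]
    linarith
  have h4 := homNorm_sub_le d (averagePart (2 * c) q P M U 0)
    (averagePart (2 * c) q P M U 0 - averagePart (2 * c) q P M U t)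
  rw [sub_sub_cancel, h2] at h4
  rw [h2] at h1
  linarith

/-- The factor `d + 1` of the derivative cancels against the denominator `d + 3` of the majorant in
degree `d + 2`. -/
theorem Admissible.weightBound_dirDeriv (h : Admissible q P M c R A B)
    {U : ℝ → FormalSeries n} (hUc : ContCoeff U)
    (hU : ∀ s, 0 ≤ s → ∀ d, homNorm d (U s) ≤ multiplierMajorant R c d s) {t : ℝ} (ht : 0 ≤ t) :
    WeightBound (c / 16) (R * dilation c t) (dirDeriv q (averagePart (2 * c) q P M U t)) := by
  intro d
  have hl1 := one_le_dilation h.c_pos.le ht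
  have hl2 := dilation_le_two c t
  have hQ := dirSize_pos q
  have hR := h.R_pos
  have hA := h.A_nonneg
  have hb := (invSq_pos (d + 2)).le
  have hb0 := (invSq_pos d).le
  have hbd : invSq (d + 2) ≤ invSq d := by
    unfold invSq
    push_cast
    gcongr
    linarith
  have h1 : (d + 1) * averageMajorant A R c (d + 2) t ≤
      8 * A * R ^ 2 * ((R * dilation c t) ^ d * invSq d) := by
    have h2 : ((d : ℝ) + 1) / (d + 3) ≤ 1 := by
      rw [div_le_one (by positivity)]; linarith
    have h3 : dilation c t ^ 3 ≤ 2 ^ 3 := by gcongr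
    calc (d + 1) * averageMajorant A R c (d + 2) t
        = A * R ^ 2 * dilation c t ^ 3 * (((d : ℝ) + 1) / (d + 3)) *
          ((R * dilation c t) ^ d * invSq (d + 2)) := by
          unfold averageMajorant
          push_cast
          rw [show (d : ℝ) + 2 + 1 = d + 3 by ring]
          ring
      _ ≤ A * R ^ 2 * 2 ^ 3 * 1 * ((R * dilation c t) ^ d * invSq d) := by gcongr
      _ = _ := by ring
  calc _ ≤ dirSize q * (d + 1) * homNorm (d + 2) (averagePart (2 * c) q P M U t) :=
        homNorm_dirDeriv_le q d _
    _ ≤ dirSize q * (d + 1) * averageMajorant A R c (d + 2) t := by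
        gcongr; exact h.homNorm_averagePart_le hUc hU ht _
    _ = dirSize q * ((d + 1) * averageMajorant A R c (d + 2) t) := by ring
    _ ≤ dirSize q * (8 * A * R ^ 2 * ((R * dilation c t) ^ d * invSq d)) := by gcongr
    _ = 8 * dirSize q * A * R ^ 2 * ((R * dilation c t) ^ d * invSq d) := by ring
    _ ≤ _ := by gcongr; exact h.small_A

/-- The majorant bounds the constant series 1 at time 0, and its derivative dominates the integrand
afterwards. -/
theorem Admissible.homNorm_picard_le (h : Admissible q P M c R A B)
    {U : ℝ → FormalSeries n} (hUc : ContCoeff U)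
    (hU : ∀ s, 0 ≤ s → ∀ d, homNorm d (U s) ≤ multiplierMajorant R c d s) {t : ℝ} (ht : 0 ≤ t)
    (d : ℕ) : homNorm d (picard (2 * c) q P M U t) ≤ multiplierMajorant R c d t := by
  have hc := h.c_pos
  have hR := h.R_pos
  have hγ : ContCoeff fun s => U s * dirDeriv q (averagePart (2 * c) q P M U s) :=
    hUc.mul ((hUc.averagePart _ q).dirDeriv q)
  have h1 : ∀ s, ∃ u', 0 ≤ s → HasDerivAt (multiplierMajorant R c d) u' s ∧
      homNorm d (U s * dirDeriv q (averagePart (2 * c) q P M U s)) ≤ u' := by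
    intro s
    by_cases hs : 0 ≤ s
    · obtain ⟨u', h2, h3⟩ := exists_hasDerivAt_multiplierMajorant hR.le hc.le hs d
      refine ⟨u', fun _ => ⟨h2, le_trans ?_ h3⟩⟩
      have hl1 := one_le_dilation hc.le hs
      refine (WeightBound.mul (by positivity) (by positivity) (by positivity)
        (weightBound_of_multiplierMajorant hR.le hc.le hs (hU s hs))
        (h.weightBound_dirDeriv hUc hU hs) d).trans (le_of_eq ?_)
      ring
    -- A dummy value at negative times, so that `choose` gives a function on all of `ℝ`.
    · exact ⟨0, fun h => absurd h hs⟩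
  choose g' hg' using h1
  have h2 := hγ.homNorm_primitive_sub_le ht (fun s hs => (hg' s hs).1) (fun s hs => (hg' s hs).2)
  rw [primitive_zero, sub_zero] at h2
  have h3 := homNorm_one_le (n := n) hR.le hc.le le_rfl d
  have h4 := homNorm_sub_le d 1
    (primitive (fun s => U s * dirDeriv q (averagePart (2 * c) q P M U s)) t)
  rw [picard]
  linarith

theorem Admissible.homNorm_iterate_le (h : Admissible q P M c R A B) (i : ℕ) (t : ℝ) (ht : 0 ≤ t)
    (d : ℕ) : homNorm d (iterate (2 * c) q P M i t) ≤ multiplierMajorant R c d t := by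
  induction i generalizing t d with
  | zero => exact homNorm_one_le h.R_pos.le h.c_pos.le ht d
  | succ i ih =>
    rw [iterate_succ]
    exact h.homNorm_picard_le (contCoeff_iterate _ q i) ih ht d

theorem Admissible.homNorm_multiplier_le (h : Admissible q P M c R A B) (hP : IsOrder 6 P)
    (hM : IsOrder 4 M) (t : ℝ) (ht : 0 ≤ t) (d : ℕ) :
    homNorm d (multiplier (2 * c) q P M t) ≤ multiplierMajorant R c d t := by
  rw [homNorm_multiplier _ q hP hM]
  exact h.homNorm_iterate_le _ t ht d

end Bounds

end Picard

/-! ### Choice of the radius -/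

theorem eventually_mul_pow_le {C R₀ K : ℝ} (hR₀ : 0 < R₀) (hK : 0 < K) (m : ℕ) :
    ∀ᶠ R : ℝ in atTop, ∀ d, m < d → C * R₀ ^ d ≤ K / R ^ m * R ^ d := by
  filter_upwards [eventually_ge_atTop R₀, eventually_ge_atTop (C * R₀ ^ (m + 1) / K)]
    with R h1 h2 d hd
  have hR : 0 < R := hR₀.trans_le h1
  obtain ⟨e, rfl⟩ := Nat.exists_eq_add_of_le (Nat.succ_le_of_lt hd)
  rw [div_le_iff₀ hK] at h2
  calc C * R₀ ^ (m.succ + e) = C * R₀ ^ (m + 1) * R₀ ^ e := by rw [Nat.succ_eq_add_one]; ring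
    _ ≤ R * K * R ^ e := by gcongr
    _ = K / R ^ m * R ^ (m.succ + e) := by
      rw [Nat.succ_eq_add_one]
      field_simp
      ring

/-- Degrees up to `m` vanish; above, the surplus `R^{d-m}` beats any constant and any geometric
growth, while `(d+1)³ ≤ 8^d` pays for the weights. -/
theorem eventually_homNorm_le {n : ℕ} {H : FormalSeries n} {m : ℕ} (hH : IsOrder (m + 1) H)
    {C R₀ K : ℝ} (hC : 0 < C) (hR₀ : 0 < R₀) (hg : GeomBound C R₀ H) (hK : 0 < K) :
    ∀ᶠ R : ℝ in atTop, ∀ d : ℕ, (d + 1) * homNorm d H ≤ K / R ^ m * (R ^ d * invSq d) := by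
  filter_upwards [eventually_mul_pow_le (C := C) (R₀ := 8 * R₀) (by positivity) hK m,
    eventually_gt_atTop 0] with R hR hRpos d
  have hb := (invSq_pos d).le
  by_cases hd : m < d
  · have h1 : ((d : ℝ) + 1) ^ 3 ≤ 8 ^ d := by
      have h2 : (d : ℝ) + 1 ≤ 2 ^ d := by exact_mod_cast (Nat.lt_two_pow_self : d < 2 ^ d)
      calc ((d : ℝ) + 1) ^ 3 ≤ (2 ^ d) ^ 3 := by gcongr
        _ = 8 ^ d := by rw [← pow_mul, mul_comm, pow_mul]; norm_num
    calc (d + 1) * homNorm d H ≤ (d + 1) * (C * R₀ ^ d) := by gcongr; exact hg d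
      _ = C * (((d : ℝ) + 1) ^ 3 * R₀ ^ d) * invSq d := by
        unfold invSq
        field_simp
      _ ≤ C * (8 ^ d * R₀ ^ d) * invSq d := by gcongr
      _ = C * (8 * R₀) ^ d * invSq d := by rw [mul_pow]
      _ ≤ K / R ^ m * R ^ d * invSq d :=
        mul_le_mul_of_nonneg_right (hR d hd) hb
      _ = _ := by ring
  · rw [hH.homNorm_eq_zero (by omega), mul_zero]
    positivity

theorem eventually_admissible {n : ℕ} (q : Fin n → ℤ) {P M : FormalSeries n} {c : ℝ} (hc : 0 < c)
    (hP : IsOrder 6 P) (hM : IsOrder 4 M) (hgP : ∃ C R : ℝ, 0 < C ∧ 0 < R ∧ GeomBound C R P)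
    (hgM : ∃ C R : ℝ, 0 < C ∧ 0 < R ∧ GeomBound C R M) :
    ∀ᶠ R : ℝ in atTop, ∃ A B, Admissible q P M c R A B := by
  obtain ⟨C, R₀, hC, hR₀, hgP⟩ := hgP
  obtain ⟨C', R₀', hC', hR₀', hgM⟩ := hgM
  have hQ := dirSize_pos q
  filter_upwards [eventually_homNorm_le (m := 4) (hP.mono (by norm_num)) hC hR₀ hgP
      (K := c ^ 2 / (128 * 1536 * dirSize q ^ 2)) (by positivity),
    eventually_homNorm_le (m := 2) (hM.mono (by norm_num)) hC' hR₀' hgM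
      (K := c / (128 * dirSize q)) (by positivity), eventually_gt_atTop 0] with R h1 h2 hR
  -- Chosen so that both smallness conditions are equalities.
  refine ⟨c / (128 * dirSize q) / R ^ 2, c ^ 2 / (128 * 1536 * dirSize q ^ 2) / R ^ 4, hc, hR,
    by positivity, by positivity, h1, h2, le_of_eq ?_, le_of_eq ?_⟩
  · field_simp
    norm_num
  · field_simp

theorem eventually_geomBound {n : ℕ} {H : FormalSeries n} (h : H ∈ analyticSeries n) :
    ∃ C : ℝ, 0 < C ∧ ∀ᶠ R : ℝ in atTop, GeomBound C R H := by
  obtain ⟨C, R₀, hC, hR₀, hH⟩ := exists_geomBound h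
  exact ⟨C, hC, (eventually_ge_atTop R₀).mono fun R hR => hH.mono le_rfl hC.le hR₀.le hR⟩

/-! ### Convergence and differential equations -/

theorem invSq_le_one (d : ℕ) : invSq d ≤ 1 := by
  unfold invSq
  rw [div_le_one (by positivity)]
  have : (0 : ℝ) ≤ d := Nat.cast_nonneg d
  nlinarith

theorem pow_mul_invSq_le {R c t : ℝ} (hR : 0 ≤ R) (hc : 0 ≤ c) (ht : 0 ≤ t) (d : ℕ) :
    (R * dilation c t) ^ d * invSq d ≤ (2 * R) ^ d := by
  have hl := one_le_dilation hc ht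
  calc (R * dilation c t) ^ d * invSq d ≤ (R * 2) ^ d * 1 := by
        gcongr
        · exact (invSq_pos d).le
        · exact dilation_le_two c t
        · exact invSq_le_one d
    _ = _ := by rw [mul_one, mul_comm]

section Limits

variable {n : ℕ} {q : Fin n → ℤ} {P M : FormalSeries n} {c R A B : ℝ}

theorem Admissible.geomBound_multiplier (h : Admissible q P M c R A B) (hP : IsOrder 6 P)
    (hM : IsOrder 4 M) {t : ℝ} (ht : 0 ≤ t) :
    GeomBound (Real.exp (c * t)) (2 * R) (multiplier (2 * c) q P M t) := fun d =>
  (weightBound_of_multiplierMajorant h.R_pos.le h.c_pos.le ht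
    (h.homNorm_multiplier_le hP hM t ht) d).trans
    (mul_le_mul_of_nonneg_left (pow_mul_invSq_le h.R_pos.le h.c_pos.le ht d) (Real.exp_pos _).le)

theorem Admissible.homNorm_averagePart_sub_le_exp (h : Admissible q P M c R A B)
    (hP : IsOrder 6 P) (hM : IsOrder 4 M) {a t : ℝ} (ha : 0 ≤ a) (hat : a ≤ t) (d : ℕ) :
    homNorm d (averagePart (2 * c) q P M (multiplier (2 * c) q P M) a -
      averagePart (2 * c) q P M (multiplier (2 * c) q P M) t) ≤
        A * Real.exp (-(c * a)) * (2 * R) ^ d := by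
  have hA := h.A_nonneg
  have hR := h.R_pos
  have hc := h.c_pos
  rw [averagePart, averagePart, sub_sub_sub_cancel_left]
  have h1 := ((contCoeff_multiplier (P := P) (M := M) (2 * c) q).averageRate (P := P) (2 * c)
    q).homNorm_primitive_sub_le (d := d) hat
    -- Replacing the dilation by 2 leaves a pure exponential rate, whose primitive vanishes at
    -- infinity.
    (g := fun s => A * (2 * R) ^ d * -Real.exp (-(c * s)))
    (fun s _ => (hasDerivAt_exp_neg_mul c s).neg.const_mul _)
    (fun s hs => by
      refine (homNorm_averageRate_le q h.c_pos h.R_pos h.B_nonneg h.bound_P h.small_B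
        (ha.trans hs) (h.homNorm_multiplier_le hP hM s (ha.trans hs)) d).trans ?_
      calc _ ≤ A * (2 * R) ^ d * (c * Real.exp (-(c * s))) := by
            gcongr
            exact pow_mul_invSq_le hR.le hc.le (ha.trans hs) d
        _ = _ := by ring)
  refine h1.trans ?_
  have : 0 ≤ A * (2 * R) ^ d * Real.exp (-(c * t)) := by positivity
  linarith

theorem Admissible.geomBound_averagePart (h : Admissible q P M c R A B) (hP : IsOrder 6 P)
    (hM : IsOrder 4 M) {t : ℝ} (ht : 0 ≤ t) :
    GeomBound (2 * A) (2 * R) (averagePart (2 * c) q P M (multiplier (2 * c) q P M) t) := by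
  intro d
  have hA := h.A_nonneg
  have hR := h.R_pos
  have hl := one_le_dilation h.c_pos.le ht
  have hb := (invSq_pos d).le
  refine (h.homNorm_averagePart_le (contCoeff_multiplier _ q)
    (h.homNorm_multiplier_le hP hM) ht d).trans ?_
  calc averageMajorant A R c d t
      = A * ((R * dilation c t) ^ d * invSq d) * dilation c t / (d + 1) := by
        unfold averageMajorant; ring
    _ ≤ A * ((R * dilation c t) ^ d * invSq d) * dilation c t :=
        div_le_self (by positivity) (by linarith [(Nat.cast_nonneg d : (0 : ℝ) ≤ d)])
    _ ≤ A * (2 * R) ^ d * 2 := by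
        gcongr
        · exact pow_mul_invSq_le hR.le h.c_pos.le ht d
        · exact dilation_le_two c t
    _ = _ := by ring

end Limits

theorem norm_coeff_le_homNorm {n : ℕ} (H : FormalSeries n) (k : MultiIndex n) :
    ‖coeff k H‖ ≤ homNorm k.degree H :=
  Finset.single_le_sum (f := fun k => ‖coeff k H‖) (fun _ _ => norm_nonneg _)
    (mem_degreeIndices.2 rfl)

theorem tendsto_exp_neg_mul (c : ℝ) (hc : 0 < c) :
    Tendsto (fun t : ℝ => Real.exp (-(c * t))) atTop (𝓝 0) :=
  Real.tendsto_exp_neg_atTop_nhds_zero.comp (tendsto_id.const_mul_atTop hc)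

/-- A curve of formal series which is Cauchy in every degree, at a common exponential rate,
converges at that rate. -/
theorem exists_limit {n : ℕ} {γ : ℝ → FormalSeries n} {A S c : ℝ} (hc : 0 < c)
    (h : ∀ a t, 0 ≤ a → a ≤ t → ∀ d, homNorm d (γ a - γ t) ≤ A * Real.exp (-(c * a)) * S ^ d) :
    ∃ H : FormalSeries n, (∀ k, Tendsto (fun t => coeff k (γ t)) atTop (𝓝 (coeff k H))) ∧
      ∀ t, 0 ≤ t → GeomBound (A * Real.exp (-(c * t))) S (γ t - H) := by
  have hexp : ∀ K : ℝ, Tendsto (fun a => A * Real.exp (-(c * a)) * K) atTop (𝓝 0) := by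
    intro K
    simpa using ((tendsto_exp_neg_mul c hc).const_mul A).mul_const K
  have hlim : ∀ k, ∃ l, Tendsto (fun t => coeff k (γ t)) atTop (𝓝 l) := by
    intro k
    refine cauchySeq_tendsto_of_complete (Metric.cauchySeq_iff'.2 fun ε hε => ?_)
    obtain ⟨a, ha, ha0⟩ := (((hexp (S ^ k.degree)).eventually_lt_const hε).and
      (eventually_ge_atTop 0)).exists
    refine ⟨a, fun t ht => ?_⟩
    rw [dist_comm, dist_eq_norm, ← map_sub]
    exact ((norm_coeff_le_homNorm _ k).trans (h a t ha0 ht _)).trans_lt ha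
  choose l hl using hlim
  obtain ⟨H, hH⟩ : ∃ H : FormalSeries n, ∀ k, coeff k H = l k := ⟨fun k => l k, fun _ => rfl⟩
  simp only [← hH] at hl
  refine ⟨H, hl, fun t ht d => ?_⟩
  have h1 : Tendsto (fun s => homNorm d (γ t - γ s)) atTop (𝓝 (homNorm d (γ t - H))) := by
    refine tendsto_finsetSum _ fun k _ => ?_
    simp only [map_sub]
    exact (tendsto_const_nhds.sub (hl k)).norm
  exact le_of_tendsto h1 ((eventually_ge_atTop t).mono fun s hs => h t s ht hs d)

theorem SatisfiesODE.const_mul {n : ℕ} {γ Φ : ℝ → FormalSeries n} (h : SatisfiesODE γ Φ)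
    (F : FormalSeries n) : SatisfiesODE (fun t => F * γ t) (fun t => F * Φ t) := by
  classical
  intro δ hδ k
  simp only [coeff_mul]
  exact HasDerivWithinAt.fun_sum fun p _ => (h δ hδ p.2).const_mul _

theorem ContCoeff.satisfiesODE_sub_primitive {n : ℕ} {γ : ℝ → FormalSeries n} (hγ : ContCoeff γ)
    (H : FormalSeries n) :
    SatisfiesODE (fun t => H - NormalizationFlow.primitive γ t) (fun t => -γ t) := by
  intro δ _ k
  simp only [map_sub, map_neg]
  exact ((hγ.hasDerivAt_primitive k δ).const_sub _).hasDerivWithinAt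

theorem satisfiesODE_multiplier {n : ℕ} (w : ℝ) (q : Fin n → ℤ) {P M : FormalSeries n}
    (hP : IsOrder 6 P) (hM : IsOrder 4 M) :
    SatisfiesODE (multiplier w q P M) (fun t => -(multiplier w q P M t *
      dirDeriv q (averagePart w q P M (multiplier w q P M) t))) := by
  have hU := contCoeff_multiplier (P := P) (M := M) w q
  have h := (hU.mul ((hU.averagePart (P := P) (M := M) w q).dirDeriv q)).satisfiesODE_sub_primitive 1
  have h2 := picard_multiplier w q hP hM
  unfold picard at h2
  rwa [h2] at h

theorem multiplier_zero {n : ℕ} (w : ℝ) (q : Fin n → ℤ) {P M : FormalSeries n}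
    (hP : IsOrder 6 P) (hM : IsOrder 4 M) : multiplier w q P M 0 = 1 := by
  rw [← picard_multiplier w q hP hM, picard, primitive_zero, sub_zero]

theorem isSolution_multiplier {n : ℕ} (ω : Fin n → ℝ) (q : Fin n → ℤ)
    {Np' Nm' N0' P : FormalSeries n} (hNp : Np' ∈ normalForms n) (hNm : Nm' ∈ normalForms n)
    (hN0 : N0' ∈ normalForms n) (hPdef : P = kappaPow (fun j => (q j).natAbs) * Nm' * Np')
    (hP : IsOrder 6 P) (hM : IsOrder 4 N0') :
    IsSolution ω q Np' Nm' N0' (fun t => Np' * multiplier (freq ω q) q P N0' t)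
      (fun t => Nm' * multiplier (freq ω q) q P N0' t)
      (averagePart (freq ω q) q P N0' (multiplier (freq ω q) q P N0')) := by
  have hPn : P ∈ normalForms n := by
    rw [hPdef]
    exact mul_mem_normalForms (mul_mem_normalForms (kappaPow_mem_normalForms _) hNm) hNp
  have hU := multiplier_mem_normalForms (freq ω q) q hPn hN0
  have hode := satisfiesODE_multiplier (freq ω q) q hP hM
  have h0 := multiplier_zero (freq ω q) q hP hM
  constructor
  · exact fun δ _ => ⟨mul_mem_normalForms hNp (hU δ), mul_mem_normalForms hNm (hU δ),
      averagePart_mem_normalForms _ q hPn hN0 hU δ⟩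
  · simp only [h0, mul_one]
  · simp only [h0, mul_one]
  · rw [averagePart, primitive_zero, sub_zero]
  · convert hode.const_mul Np' using 2
    ring
  · convert hode.const_mul Nm' using 2
    ring
  · have hUc := contCoeff_multiplier (P := P) (M := N0') (freq ω q) q
    intro δ hδ k
    refine ((hUc.averageRate (P := P) (freq ω q) q).satisfiesODE_sub_primitive N0' δ hδ
      k).congr_deriv (congrArg (coeff k) ?_)
    simp only [averageRate, ← neg_smul]
    congr 2
    · push_cast; ring
    · rw [hPdef]; ring

theorem mem_normalForms_of_tendsto {n : ℕ} {γ : ℝ → FormalSeries n} {H : FormalSeries n}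
    (hγ : ∀ t, γ t ∈ normalForms n)
    (h : ∀ k, Tendsto (fun t => coeff k (γ t)) atTop (𝓝 (coeff k H))) : H ∈ normalForms n := by
  intro k hk
  by_contra h0
  refine hk (tendsto_nhds_unique (h k) ?_)
  have : ∀ t, coeff k (γ t) = 0 := fun t => by
    by_contra h1
    exact h0 (hγ t k h1)
  simp [this]

theorem tendsto_supNorm_exp_smul {n : ℕ} {γ : ℝ → FormalSeries n} {c C S ρ : ℝ} (hc : 0 < c)
    (hρ : 0 < ρ) (hS : 0 ≤ S) (hSρ : S * ρ ≤ 1 / 2)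
    (h : ∀ t, 0 ≤ t → GeomBound (C * Real.exp (c * t)) S (γ t)) :
    Tendsto (fun t : ℝ => supNorm ρ ((Real.exp (-(2 * c) * t) : ℂ) • γ t)) atTop (𝓝 0) := by
  have h1 : Tendsto (fun t : ℝ => 2 * C * Real.exp (-(c * t))) atTop (𝓝 0) := by
    simpa using (tendsto_exp_neg_mul c hc).const_mul (2 * C)
  refine squeeze_zero' (Eventually.of_forall fun t => supNorm_nonneg _ _)
    ((eventually_ge_atTop 0).mono fun t ht => ?_) h1
  refine (((h t ht).smul _).supNorm_le hρ hS hSρ).trans (le_of_eq ?_)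
  rw [Complex.norm_real, Real.norm_of_nonneg (Real.exp_pos _).le]
  have : Real.exp (-(c * t)) = Real.exp (-(2 * c) * t) * Real.exp (c * t) := by
    rw [← Real.exp_add]; congr 1; ring
  rw [this]
  ring

end

end NormalizationFlow

/-! ### The main theorem. -/

open NormalizationFlow Filter Topology in
theorem mainTheorem3 {n : ℕ} (ω : Fin n → ℝ) (hω : Nonresonant ω)
    (q : Fin n → ℤ) (hq : q ≠ 0) (hσ : 0 < freqSign ω q)
    (Np' Nm' N0' : FormalSeries n)
    (hNp : Np' ∈ normalForms n ∩ analyticSeries n)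
    (hNm : Nm' ∈ normalForms n ∩ analyticSeries n)
    (hN0 : N0' ∈ normalForms n ∩ analyticSeries n)
    (hOp : IsOrder 3 (harmonicMonomial q * Np'))
    (hOm : IsOrder 3 (harmonicMonomial (-q) * Nm'))
    (hO0 : IsOrderKappa 2 N0') :
    ∃ ρ : ℝ, 0 < ρ ∧ ∃ Np Nm N0 : ℝ → FormalSeries n,
      IsSolution ω q Np' Nm' N0' Np Nm N0 ∧
      (∀ δ : ℝ, 0 ≤ δ →
        Np δ ∈ boundedAnalytic n ρ ∧ Nm δ ∈ boundedAnalytic n ρ ∧ N0 δ ∈ boundedAnalytic n ρ) ∧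
      Tendsto (fun δ : ℝ => supNorm ρ ((Real.exp (-(freq ω q) * δ) : ℂ) • Np δ)) atTop (𝓝 0) ∧
      Tendsto (fun δ : ℝ => supNorm ρ ((Real.exp (-(freq ω q) * δ) : ℂ) • Nm δ)) atTop (𝓝 0) ∧
      ∃ Ninf ∈ normalForms n ∩ boundedAnalytic n ρ,
        Tendsto (fun δ : ℝ => supNorm ρ (N0 δ - Ninf)) atTop (𝓝 0) := by
  have hfreq : 0 < freq ω q := abs_pos.2 (sign_eq_one_iff.1 (SignType.pos_iff.1 hσ)).ne'
  -- Half the frequency is spent on the growth of `U`; the other half remains as decay.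
  obtain ⟨c, hcdef⟩ : ∃ c, freq ω q = 2 * c := ⟨freq ω q / 2, by ring⟩
  have hc : 0 < c := by linarith
  obtain ⟨P, hPdef⟩ : ∃ P, P = kappaPow (fun j => (q j).natAbs) * Nm' * Np' := ⟨_, rfl⟩
  have hP : IsOrder 6 P := hPdef ▸ isOrder_kappaPow_mul hOp hOm
  have hM : IsOrder 4 N0' := isOrder_of_isOrderKappa hN0.1 hO0
  have hgP : ∃ C R : ℝ, 0 < C ∧ 0 < R ∧ GeomBound C R P := by
    rw [hPdef]
    exact exists_geomBound_mul (exists_geomBound_mul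
      (exists_geomBound (kappaPow_mem_analyticSeries _)) (exists_geomBound hNm.2))
      (exists_geomBound hNp.2)
  obtain ⟨Cp, hCp, hgp⟩ := eventually_geomBound hNp.2
  obtain ⟨Cm, hCm, hgm⟩ := eventually_geomBound hNm.2
  obtain ⟨R, ⟨A, B, hadm⟩, hRp, hRm⟩ :=
    ((eventually_admissible q hc hP hM hgP (exists_geomBound hN0.2)).and (hgp.and hgm)).exists
  have hR := hadm.R_pos
  have hsol := isSolution_multiplier ω q hNp.1 hNm.1 hN0.1 hPdef hP hM
  -- The multiplier has growth rate `2R`, its product with the initial data `4R`; at this radius the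
  -- geometric ratio is `1/2`.
  have hρ : 0 < 1 / (8 * R) := by positivity
  have hρ4 : 2 * (2 * R) * (1 / (8 * R)) ≤ 1 / 2 := le_of_eq (by field_simp; norm_num)
  have hρ2 : 2 * R * (1 / (8 * R)) ≤ 1 / 2 := le_trans (by gcongr; linarith) hρ4
  have hbound : ∀ {C : ℝ} {F : FormalSeries n}, 0 < C → GeomBound C R F → ∀ t, 0 ≤ t →
      GeomBound (C * Real.exp (c * t)) (2 * (2 * R)) (F * multiplier (2 * c) q P N0' t) :=
    fun hC hF t ht => GeomBound.mul hC.le (by positivity)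
      (hF.mono le_rfl hC.le hR.le (by linarith)) (hadm.geomBound_multiplier hP hM ht)
  have havg : ∀ t, 0 ≤ t → averagePart (2 * c) q P N0' (multiplier (2 * c) q P N0') t ∈
      boundedAnalytic n (1 / (8 * R)) := fun t ht =>
    (hadm.geomBound_averagePart hP hM ht).mem_boundedAnalytic hρ (by positivity) hρ2
  obtain ⟨Ninf, hlim, hrate⟩ := exists_limit hc fun a t ha hat =>
    hadm.homNorm_averagePart_sub_le_exp hP hM ha hat
  rw [hcdef] at hsol ⊢
  refine ⟨1 / (8 * R), hρ, _, _, _, hsol, fun t ht =>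
    ⟨(hbound hCp hRp t ht).mem_boundedAnalytic hρ (by positivity) hρ4,
      (hbound hCm hRm t ht).mem_boundedAnalytic hρ (by positivity) hρ4, havg t ht⟩,
    ?_, ?_, Ninf, ⟨?_, ?_⟩, ?_⟩
  · exact_mod_cast tendsto_supNorm_exp_smul hc hρ (by positivity) hρ4 (hbound hCp hRp)
  · exact_mod_cast tendsto_supNorm_exp_smul hc hρ (by positivity) hρ4 (hbound hCm hRm)
  · have hPn : P ∈ normalForms n := by
      rw [hPdef]
      exact mul_mem_normalForms (mul_mem_normalForms (kappaPow_mem_normalForms _) hNm.1) hNp.1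
    exact mem_normalForms_of_tendsto (averagePart_mem_normalForms _ q hPn hN0.1
      (multiplier_mem_normalForms _ q hPn hN0.1)) hlim
  -- `Ninf` is `N⁰(0)` minus the distance already bounded by `hrate` at time 0.
  · have h1 : GeomBound (2 * A + A) (2 * R) Ninf := by
      intro d
      have h2 := homNorm_sub_le d (averagePart (2 * c) q P N0' (multiplier (2 * c) q P N0') 0)
        (averagePart (2 * c) q P N0' (multiplier (2 * c) q P N0') 0 - Ninf)
      rw [sub_sub_cancel] at h2
      have h3 := hrate 0 le_rfl d
      rw [mul_zero, neg_zero, Real.exp_zero, mul_one] at h3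
      have h4 := hadm.geomBound_averagePart hP hM le_rfl d
      rw [add_mul]
      linarith
    exact h1.mem_boundedAnalytic hρ (by positivity) hρ2
  · have h1 : Tendsto (fun t : ℝ => 2 * (A * Real.exp (-(c * t)))) atTop (𝓝 0) := by
      simpa using ((tendsto_exp_neg_mul c hc).const_mul A).const_mul 2
    exact squeeze_zero' (Eventually.of_forall fun t => supNorm_nonneg _ _)
      ((eventually_ge_atTop 0).mono fun t ht =>
        (hrate t ht).supNorm_le hρ (by positivity) hρ2) h1
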